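/- Let $A$ be a finite-dimensional real alternative algebra with unit $1\neq 0$ (with $\mathbb R$ identified with $\mathbb R 1$), equipped with a $^*$-involution, i.e. a real linear map $x\mapsto x^c$ with $(x^c)^c=x$, $(xy)^c=y^cx^c$ and $r^c=r$ for $r\in\mathbb R$. Put $t(x)=x+x^c$, $n(x)=xx^c$, $\mathbb S_A=\{J\in A: t(J)=0,\ n(J)=1\}$, $\mathbb C_J=\mathbb R+\mathbb RJ$, and let $Q_A=\mathbb R\cup\{x: t(x),n(x)\in\mathbb R,\ t(x)^2<4n(x)\}=\bigcup_{J\in\mathbb S_A}\mathbb C_J$ be the quadratic cone. Assume that $\mathbb S_A\ne\emptyset$ and that $A$ carries a norm $\|\cdot\|$ of real vector spaces with $\|x\|^2=n(x)$ for all $x\in Q_A$. A $^*$-algebra is called nonsingular if $n(x)=0$ implies $x=0$ for each of its elements $x$. For $E\subseteq\mathbb C$ let $\Omega_E=\{\alpha+\beta J:\alpha+i\beta\in E,\ J\in\mathbb S_A\}$; the sets $\Omega_E$ are called circular. Let $D\subseteq \mathbb C$ be invariant under complex conjugation. A slice function on $\Omega_D$ is a function $f=\mathcal I(F)$ of the form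 $f(\alpha+\beta J)=F_1(\alpha+i\beta)+JF_2(\alpha+i\beta)$, where the stem function $F=F_1+\imath F_2:D\to A_{\mathbb C}=A\otimes_{\mathbb R}\mathbb C$ satisfies $F(\bar z)=\overline{F(z)}$. It is slice preserving if $F_1,F_2$ are real valued. If $\Omega_D$ is open in $Q_A$, it is slice regular if $F$ is of class $C^1$ and $\partial F/\partial\bar z=0$. The slice product and the conjugation are $\mathcal I(F)\cdot\mathcal I(G)=\mathcal I(FG)$ and $\mathcal I(F)^c=\mathcal I(F^c)$, where $(x+\imath y)^c=x^c+\imath y^c$ in $A_{\mathbb C}$; moreover $N(f)=f\cdot f^c$. A slice function $f$ is tame if $N(f)$ is slice preserving and $N(f)=N(f^c)$. For $x,y\in Q_A$ put $\sigma(x,y)=\tau(x,y)=\|x-y\|$ if $x,y$ lie in a common $\mathbb C_J$; otherwise let $\sigma(x,y)$, respectively $\tau(x,y)$, be $\big(\|\mathrm{re}(x)-\mathrm{re}(y)\|^2+(\|\mathrm{im}(x)\|\pm\|\mathrm{im}(y)\|)^2\big)^{1/2}$ with sign $+$, respectively $-$, where $\mathrm{re}(x)=t(x)/2$ and $\mathrm{im}(x)=x-\mathrm{re}(x)$.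 Let $\Sigma(y,0,R)=\{x\in Q_A:\tau(x,y)>0,\ \sigma(x,y)<R\}$. A point $y\in Q_A$ is a singularity of a slice regular function $f$ on $\Omega'$ if $\Sigma(y,0,R)\subseteq\Omega'$ for some $R>0$. It is a pole if for some such $R$ one has $f(x)=\sum_{n\in\mathbb Z}(x-y)^{\bullet n}\cdot a_n$ on $\Sigma(y,0,R)$, where $a_n\in A$, $a_n=0$ for all sufficiently negative $n$, and $(x-y)^{\bullet n}$ are the powers for the slice product. It is removable if $f$ extends to a slice regular function on a circular open set containing $\Omega'$ and $y$. A semiregular function on a circular open set $\Omega\subseteq Q_A$ is a slice regular function $f$ on a circular open set $\Omega'\subseteq\Omega$ such that every point of $\Omega\setminus\Omega'$ is a pole or a removable singularity of $f$; semiregular functions that agree on their common domain are identified (equivalently, $f$ is extended through all its removable singularities, so that $\Omega\setminus\Omega'$ is the set of its nonremovable poles). It is tame if it is tame on $\Omega'$. A slice domain is a circular set $\Omega=\Omega_D$, open in $Q_A$, with $D\subseteq\mathbb C$ invariant under conjugation, connected, and intersecting the real line. **Theorem.** Suppose that $A$ is nonsingular and that $\Omega$ is a slice domain. Then the semiregular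 functions on $\Omega$, with the pointwise linear operations, the slice product and the conjugation $f\mapsto f^c$ (performed on common domains), form a nonsingular real alternative $^*$-algebra. Within it, let $T$ be the set of all tame elements that are not identically $0$. Then $T$ is a multiplicative Moufang loop: it is closed under the product, it has a neutral element, for all $a,b\in T$ each of the equations $ax=b$ and $ya=b$ has exactly one solution in $T$, and the Moufang identities $z(x(zy))=((zx)z)y$, $x(z(yz))=((xz)y)z$, $(zx)(yz)=(z(xy))z$, $(zx)(yz)=z((xy)z)$ hold. Moreover $T$ is preserved by the $^*$-involution: $f\in T$ implies $f^c\in T$. -/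

import Mathlib

open scoped ComplexConjugate

/-- A unital, not necessarily associative, ring with a norm of its additive group.
No compatibility between the norm and the product is required. -/
class NonAssocNormedRing (A : Type*) extends Norm A, NonAssocRing A, MetricSpace A where
  /-- The distance is induced by the norm. -/
  dist_eq : ∀ x y, dist x y = norm (-x + y)

instance (priority := 100) NonAssocNormedRing.toNormedAddCommGroup {A : Type*}
    [β : NonAssocNormedRing A] : NormedAddCommGroup A :=
  { β with }

namespace SliceAlg

/-! ### Alternative `*`-algebras and their quadratic cone -/

section Algebra

variable {A : Type*} [NonAssocNormedRing A] [NormedSpace ℝ A] [StarRing A]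

/-- The trace `t(x) = x + x^c`. -/
def tr (x : A) : A := x + star x

/-- The (squared) norm `n(x) = x x^c`. -/
def nm (x : A) : A := x * star x

/-- The real part `t(x)/2`, as an element of `A`. -/
noncomputable def rePart (x : A) : A := (1 / 2 : ℝ) • tr x

/-- The imaginary part `x - re(x)`. -/
noncomputable def imPart (x : A) : A := x - rePart x

variable (A) in
/-- The set `𝕊_A` of imaginary units: `t(x) = 0` and `n(x) = 1`. -/
def imUnits : Set A := {x | tr x = 0 ∧ nm x = 1}

variable (A) in
/-- The quadratic cone `Q_A`, with `ℝ` identified with `ℝ • 1`. -/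
def quadCone : Set A :=
  {x | (∃ r : ℝ, x = r • (1 : A)) ∨
    ∃ t n : ℝ, tr x = t • (1 : A) ∧ nm x = n • (1 : A) ∧ t ^ 2 < 4 * n}

end Algebra

/-- The standing assumptions on a real unital finite-dimensional `*`-algebra `A`: it is alternative,
it has imaginary units, and its norm restricts to the square root of `n` on the quadratic cone. -/
class AlternativeStarAlgebra (A : Type*) [NonAssocNormedRing A] [NormedSpace ℝ A] [StarRing A] :
    Prop where
  left_alternative : ∀ x y : A, (x * x) * y = x * (x * y)
  right_alternative : ∀ x y : A, (y * x) * x = y * (x * x)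
  imUnits_nonempty : (imUnits A).Nonempty
  norm_sq_eq : ∀ x ∈ quadCone A, nm x = (‖x‖ ^ 2) • (1 : A)

/-! ### The complexification of an algebra -/

/-- The complexification `A_ℂ = {x + ι y | x, y ∈ A}`. -/
@[ext]
structure Cplx (A : Type*) where
  /-- the component `x` of `x + ι y` -/
  re : A
  /-- the component `y` of `x + ι y` -/
  im : A

namespace Cplx

variable {A : Type*} [NonAssocRing A]

instance : One (Cplx A) := ⟨⟨1, 0⟩⟩

/-- `(x + ι y)(x' + ι y') = x x' - y y' + ι (x y' + y x')`. -/
instance : Mul (Cplx A) :=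
  ⟨fun v w => ⟨v.re * w.re - v.im * w.im, v.re * w.im + v.im * w.re⟩⟩

/-- The `*`-involution `(x + ι y)^c = x^c + ι y^c`. -/
instance [StarRing A] : Star (Cplx A) := ⟨fun w => ⟨star w.re, star w.im⟩⟩

/-- The complex conjugation `x + ι y ↦ x - ι y`. -/
def bar (w : Cplx A) : Cplx A := ⟨w.re, -w.im⟩

/-- An element `a` of `A` as an element of `A_ℂ`. -/
def const (a : A) : Cplx A := ⟨a, 0⟩

open Classical in
/-- The multiplicative inverse in `A_ℂ`, and `0` when there is none. -/
noncomputable def inverse (w : Cplx A) : Cplx A :=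
  if h : ∃ v : Cplx A, w * v = 1 ∧ v * w = 1 then h.choose else ⟨0, 0⟩

/-- Integer powers in `A_ℂ`. -/
noncomputable def zpow (w : Cplx A) : ℤ → Cplx A
  | Int.ofNat n => npowRec n w
  | Int.negSucc n => npowRec (n + 1) w.inverse

/-- The map `x + ι y ↦ x + J y`. -/
def slice (J : A) (w : Cplx A) : A := w.re + J * w.im

/-- The element `x + ι y` is in `ℝ_ℂ`, i.e. `x` and `y` are real. -/
def IsReal [Module ℝ A] (w : Cplx A) : Prop :=
  (∃ r : ℝ, w.re = r • (1 : A)) ∧ ∃ r : ℝ, w.im = r • (1 : A)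

end Cplx

section Functions

variable {A : Type*} [NonAssocNormedRing A] [NormedSpace ℝ A] [StarRing A]

/-! ### Circular sets -/

/-- The point `α + β J` of `A`, for `z = α + i β`. -/
noncomputable def sliceEmb (J : A) (z : ℂ) : A := z.re • (1 : A) + z.im • J

variable (A) in
/-- The circularization `Ω_E` of a subset `E` of `ℂ`. -/
def circularization (E : Set ℂ) : Set A :=
  {x | x ∈ quadCone A ∧ ∃ z ∈ E, ∃ J ∈ imUnits A, x = sliceEmb J z}

/-- `Ω` is a circular subset of the quadratic cone. -/
def IsCircular (Ω : Set A) : Prop := ∃ E : Set ℂ, Ω = circularization A E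

/-- `Ω` is a relatively open subset of the quadratic cone. -/
def IsOpenInCone (Ω : Set A) : Prop := ∃ U : Set A, IsOpen U ∧ Ω = U ∩ quadCone A

/-- For a circular set `Ω`, the only subset `D` of `ℂ` that is invariant under complex conjugation
and has `Ω = Ω_D`. -/
def profile (Ω : Set A) : Set ℂ := {z | ∃ J ∈ imUnits A, sliceEmb J z ∈ Ω}

/-- `Ω = Ω_D` is open in the quadratic cone, with `D` connected and intersecting the real line. -/
def IsSliceDomain (Ω : Set A) : Prop :=
  IsCircular Ω ∧ IsOpenInCone Ω ∧ IsConnected (profile Ω) ∧ ∃ r : ℝ, (r : ℂ) ∈ profile Ω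

/-! ### Slice functions

In what follows a function with domain `Ω = Ω_D` is represented by a map `A → A`, of which only the
values on `Ω` matter. -/

/-- `F` is a stem function on `D`: `F (conj z) = bar (F z)`. -/
def IsStemOn (D : Set ℂ) (F : ℂ → Cplx A) : Prop := ∀ z ∈ D, F (conj z) = (F z).bar

/-- On `Ω_D` the function `f` is induced by `F`, i.e. `f = 𝓘(F)`:
`f (α + β J) = F₁ (α + i β) + J F₂ (α + i β)`. -/
def Induces (D : Set ℂ) (F : ℂ → Cplx A) (f : A → A) : Prop :=
  ∀ z ∈ D, ∀ J ∈ imUnits A, f (sliceEmb J z) = (F z).slice J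

/-- On the circular set `Ω`, the function `p` is the slice product of the slice functions
`f` and `g`. -/
def IsSliceMul (Ω : Set A) (f g p : A → A) : Prop :=
  ∃ F G : ℂ → Cplx A, IsStemOn (profile Ω) F ∧ IsStemOn (profile Ω) G ∧
    Induces (profile Ω) F f ∧ Induces (profile Ω) G g ∧
    Induces (profile Ω) (fun z => F z * G z) p

/-- On the circular set `Ω`, the function `g` is the conjugate `f^c` of the slice function `f`. -/
def IsSliceConj (Ω : Set A) (f g : A → A) : Prop :=
  ∃ F : ℂ → Cplx A, IsStemOn (profile Ω) F ∧ Induces (profile Ω) F f ∧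
    Induces (profile Ω) (fun z => star (F z)) g

/-- On the circular set `Ω`, the function `p` is the normal function `N(f) = f · f^c`. -/
def IsNormalFun (Ω : Set A) (f p : A → A) : Prop :=
  ∃ g : A → A, IsSliceConj Ω f g ∧ IsSliceMul Ω f g p

/-- `f` is a slice function on `Ω` induced by a stem function with real components. -/
def IsSlicePreserving (Ω : Set A) (f : A → A) : Prop :=
  ∃ F : ℂ → Cplx A, IsStemOn (profile Ω) F ∧ Induces (profile Ω) F f ∧
    ∀ z ∈ profile Ω, (F z).IsReal

/-- `f` is a tame slice function on `Ω`: `N(f)` is slice preserving and coincides with `N(f^c)`. -/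
def IsTameOn (Ω : Set A) (f : A → A) : Prop :=
  ∃ p : A → A, IsNormalFun Ω f p ∧ IsSlicePreserving Ω p ∧
    ∃ g : A → A, IsSliceConj Ω f g ∧ IsNormalFun Ω g p

/-- `F = F₁ + ι F₂` is of class `C¹` on the open set `D` and `∂F/∂α + ι ∂F/∂β = 0` there. -/
def IsHolomorphicStemOn (D : Set ℂ) (F : ℂ → Cplx A) : Prop :=
  ContDiffOn ℝ 1 (fun z => (F z).re) D ∧ ContDiffOn ℝ 1 (fun z => (F z).im) D ∧
    ∀ z ∈ D,
      fderiv ℝ (fun w => (F w).re) z 1 - fderiv ℝ (fun w => (F w).im) z Complex.I = 0 ∧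
      fderiv ℝ (fun w => (F w).im) z 1 + fderiv ℝ (fun w => (F w).re) z Complex.I = 0

/-- `Ω` is a circular open subset of the quadratic cone and `f` is slice regular on `Ω`. -/
def IsSliceRegularOn (Ω : Set A) (f : A → A) : Prop :=
  IsCircular Ω ∧ IsOpenInCone Ω ∧
    ∃ F : ℂ → Cplx A, IsStemOn (profile Ω) F ∧ Induces (profile Ω) F f ∧
      IsHolomorphicStemOn (profile Ω) F

/-! ### Laurent expansions and singularities -/

/-- The slice plane `ℂ_J`. -/
def slicePlane (J : A) : Set A := Set.range (sliceEmb J)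

/-- `x` and `y` lie in the same `ℂ_J`. -/
def SameSlice (x y : A) : Prop := ∃ J ∈ imUnits A, x ∈ slicePlane J ∧ y ∈ slicePlane J

open Classical in
/-- The distance `σ_A` on the quadratic cone. -/
noncomputable def sigmaDist (x y : A) : ℝ :=
  if SameSlice x y then ‖x - y‖
  else √(‖rePart x - rePart y‖ ^ 2 + (‖imPart x‖ + ‖imPart y‖) ^ 2)

open Classical in
/-- The pseudodistance `τ_A` on the quadratic cone. -/
noncomputable def tauDist (x y : A) : ℝ :=
  if SameSlice x y then ‖x - y‖
  else √(‖rePart x - rePart y‖ ^ 2 + (‖imPart x‖ - ‖imPart y‖) ^ 2)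

/-- The set `Σ(y, R₁, R₂)`. -/
def sigmaShell (y : A) (R₁ R₂ : ℝ) : Set A :=
  {x | x ∈ quadCone A ∧ R₁ < tauDist x y ∧ sigmaDist x y < R₂}

/-- The stem function inducing `x ↦ (x - y)^{•n} · a`. -/
noncomputable def laurentStem (y a : A) (n : ℤ) (z : ℂ) : Cplx A :=
  Cplx.zpow ⟨z.re • (1 : A) - y, z.im • (1 : A)⟩ n * Cplx.const a

/-- `f (x) = ∑_{n ∈ ℤ} (x - y)^{•n} · a_n` for all `x` in `S`. -/
def HasLaurentExpansionOn (S : Set A) (f : A → A) (y : A) (a : ℤ → A) : Prop :=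
  ∀ z : ℂ, ∀ J ∈ imUnits A, sliceEmb J z ∈ S →
    HasSum (fun n : ℤ => (laurentStem y (a n) n z).slice J) (f (sliceEmb J z))

/-- `y` is a pole, of some finite order `m ≥ 0`, for the slice regular function `f` on `Ω`. -/
def IsPole (Ω : Set A) (f : A → A) (y : A) : Prop :=
  y ∈ quadCone A ∧ ∃ R : ℝ, 0 < R ∧ sigmaShell y 0 R ⊆ Ω ∧
    ∃ a : ℤ → A, HasLaurentExpansionOn (sigmaShell y 0 R) f y a ∧
      ∃ m : ℕ, ∀ k : ℕ, m < k → a (-(k : ℤ)) = 0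

/-- `y` is a removable singularity for the slice regular function `f` on `Ω`. -/
def IsRemovableSingularity (Ω : Set A) (f : A → A) (y : A) : Prop :=
  y ∈ quadCone A ∧ (∃ R : ℝ, 0 < R ∧ sigmaShell y 0 R ⊆ Ω) ∧
    ∃ (Ω₁ : Set A) (f₁ : A → A), Ω ⊆ Ω₁ ∧ y ∈ Ω₁ ∧ IsSliceRegularOn Ω₁ f₁ ∧ Set.EqOn f₁ f Ω

/-! ### Semiregular functions -/

/-- `f`, defined and slice regular on the circular open subset `Ω'` of `Ω`, is semiregular in `Ω`:
each point of `Ω \ Ω'` is a pole or a removable singularity. -/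
def IsSemiregularOn (Ω Ω' : Set A) (f : A → A) : Prop :=
  Ω' ⊆ Ω ∧ IsSliceRegularOn Ω' f ∧
    ∀ y ∈ Ω \ Ω', IsPole Ω' f y ∨ IsRemovableSingularity Ω' f y

/-- The semiregular functions on `Ω`. Two semiregular functions which coincide where both are
defined are the same function: each of them is given by its extension through all of its removable
singularities, so that the points of `Ω` outside its domain `dom` are its nonremovable poles.
Outside `dom` the underlying map has the conventional value `0`. -/
@[ext]
structure Semiregular (Ω : Set A) where
  /-- the domain, i.e. `Ω` without the nonremovable poles -/
  dom : Set A
  /-- the values -/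
  toFun : A → A
  semiregular : IsSemiregularOn Ω dom toFun
  not_removable : ∀ y ∈ Ω \ dom, ¬ IsRemovableSingularity dom toFun y
  eq_zero_off : ∀ x, x ∉ dom → toFun x = 0

/-- A `*`-algebra is nonsingular when `n(x) = 0` implies `x = 0`. -/
def IsNonsingular (B : Type*) [NonAssocRing B] [StarRing B] : Prop :=
  ∀ x : B, x * star x = 0 → x = 0

/-- The ring structure, scalar multiplication and involution given on the semiregular functions on
`Ω` make them a real alternative `*`-algebra, and they are the pointwise linear operations, the
slice product and the slice conjugation. -/
structure IsSemiregularAlgebra (Ω : Set A) [NonAssocRing (Semiregular Ω)]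
    [Module ℝ (Semiregular Ω)] [StarRing (Semiregular Ω)] : Prop where
  smul_mul : ∀ (r : ℝ) (f g : Semiregular Ω), (r • f) * g = r • (f * g)
  mul_smul : ∀ (r : ℝ) (f g : Semiregular Ω), f * (r • g) = r • (f * g)
  star_smul : ∀ (r : ℝ) (f : Semiregular Ω), star (r • f) = r • star f
  left_alternative : ∀ f g : Semiregular Ω, (f * f) * g = f * (f * g)
  right_alternative : ∀ f g : Semiregular Ω, (g * f) * f = g * (f * f)
  zero_spec : (0 : Semiregular Ω).dom = Ω ∧ ∀ x ∈ Ω, (0 : Semiregular Ω).toFun x = 0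
  one_spec : (1 : Semiregular Ω).dom = Ω ∧ ∀ x ∈ Ω, (1 : Semiregular Ω).toFun x = 1
  add_spec : ∀ f g : Semiregular Ω, f.dom ∩ g.dom ⊆ (f + g).dom ∧
    ∀ x ∈ f.dom ∩ g.dom, (f + g).toFun x = f.toFun x + g.toFun x
  smul_spec : ∀ (r : ℝ) (f : Semiregular Ω), f.dom ⊆ (r • f).dom ∧
    ∀ x ∈ f.dom, (r • f).toFun x = r • f.toFun x
  mul_spec : ∀ f g : Semiregular Ω, f.dom ∩ g.dom ⊆ (f * g).dom ∧
    IsSliceMul (f.dom ∩ g.dom) f.toFun g.toFun (f * g).toFun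
  star_spec : ∀ f : Semiregular Ω, f.dom ⊆ (star f).dom ∧
    IsSliceConj f.dom f.toFun (star f).toFun

/-- The set of tame semiregular functions on `Ω` that are not identically `0`. -/
def tameNonzero (Ω : Set A) : Set (Semiregular Ω) :=
  {f | IsTameOn f.dom f.toFun ∧ ∃ x ∈ f.dom, f.toFun x ≠ 0}

end Functions

/-! ### Moufang loops -/

/-- The subset `T` is a Moufang loop under the given product: it is closed, it has a neutral
element, both equations `a x = b` and `y a = b` have exactly one solution in `T`, and the (mutually
equivalent) Moufang identities hold. -/
structure IsMoufangLoop {M : Type*} [Mul M] (T : Set M) : Prop where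
  mul_mem : ∀ a ∈ T, ∀ b ∈ T, a * b ∈ T
  exists_one : ∃ e ∈ T, ∀ a ∈ T, e * a = a ∧ a * e = a
  left_div : ∀ a ∈ T, ∀ b ∈ T, ∃! x, x ∈ T ∧ a * x = b
  right_div : ∀ a ∈ T, ∀ b ∈ T, ∃! y, y ∈ T ∧ y * a = b
  moufang_left : ∀ x ∈ T, ∀ y ∈ T, ∀ z ∈ T, z * (x * (z * y)) = ((z * x) * z) * y
  moufang_right : ∀ x ∈ T, ∀ y ∈ T, ∀ z ∈ T, x * (z * (y * z)) = ((x * z) * y) * z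
  moufang_middle : ∀ x ∈ T, ∀ y ∈ T, ∀ z ∈ T, (z * x) * (y * z) = (z * (x * y)) * z
  moufang_middle' : ∀ x ∈ T, ∀ y ∈ T, ∀ z ∈ T, (z * x) * (y * z) = z * ((x * y) * z)

end SliceAlg

set_option linter.unusedSectionVars false

open Filter Topology

/-! ### Alternative rings -/

/-! Everything is moved to stem functions. The complexification `Cplx A` is a finite-dimensional
complex alternative `*`-algebra in which ι acts as the scalar `Complex.I`, and slice regularity of a
function means holomorphy of its stem function (`isHolomorphicStemOn_iff`). The main analytic claim
is that semiregular functions on Ω, extended through their removable singularities, correspond to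
meromorphic `Cplx A`-valued functions F on the profile D with F(conj z) = bar F(z), taken up to
equality on codiscrete sets.

The bridge to Laurent expansions is the idempotent e = (1 - ιJ)/2. The map x + ιy ↦ x + Jy depends
only on the component e·v, and z - y splits as (z - ζ)e + (z - conj ζ)e' for y = α + βJ, ζ = α + iβ.
Hence the slice powers of x - y restrict on ℂ_J to ordinary powers of z - ζ, and a finite principal
part amounts to meromorphy (`IsPole.meromorphicAt`, `isPole_of_meromorphicAt`). Normal forms single
out one representative of each germ (`Semiregular.normalForm_stem`), so algebraic identities for
semiregular functions follow from pointwise identities in `Cplx A`.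

Nonsingularity comes from the real line. There a stem function takes values in A, so N(f) = 0 gives
F = 0 at real points accumulating in D, and the identity theorem on the connected set D gives f = 0.
Consequently a nonzero tame f has, off a discrete set, F F^c = F^c F = c with c a nonzero complex
scalar (`Semiregular.mem_tameNonzero_iff`).

The rest is alternative algebra. If ab = ba = c is a nonzero scalar, then b(ax) = cx for every x, so
c⁻¹F^c is the stem function of a two-sided inverse that solves the division equations. A Moufang
identity gives (xy)(y^c x^c) = n(x)n(y) for such elements, whence closure under products. The
Moufang identities themselves hold in every alternative ring. -/

/-- A nonassociative ring in which the associator is alternating. -/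
class IsAlternativeRing (B : Type*) [NonAssocRing B] : Prop where
  left_alt : ∀ x y : B, (x * x) * y = x * (x * y)
  right_alt : ∀ x y : B, (y * x) * x = y * (x * x)

namespace IsAlternativeRing

open MulOpposite

variable {B : Type*} [NonAssocRing B] [IsAlternativeRing B]

/-- Passing to the opposite ring lets each right-handed law be read off from its left-handed
counterpart. -/
instance : IsAlternativeRing Bᵐᵒᵖ where
  left_alt x y := by
    apply unop_injective
    simp only [unop_mul]
    exact (right_alt _ _).symm
  right_alt x y := by
    apply unop_injective
    simp only [unop_mul]
    exact (left_alt _ _).symm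

theorem left_alt_linearized (x y z : B) :
    (x * y) * z + (y * x) * z = x * (y * z) + y * (x * z) := by
  have h := left_alt (x + y) z
  have hx := left_alt x z
  have hy := left_alt y z
  simp only [add_mul, mul_add] at h
  rw [hx, hy] at h
  have h' : x * (x * z) + y * (y * z) + ((x * y) * z + (y * x) * z)
      = x * (x * z) + y * (y * z) + (x * (y * z) + y * (x * z)) := by
    convert h using 1 <;> abel
  exact add_left_cancel h'

theorem right_alt_linearized (x y z : B) :
    (z * x) * y + (z * y) * x = z * (x * y) + z * (y * x) := by
  have h := congrArg unop (left_alt_linearized (op x) (op y) (op z))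
  simp only [unop_mul, unop_add, unop_op] at h
  rw [add_comm, ← h, add_comm]

theorem flexible (x y : B) : (x * y) * x = x * (y * x) := by
  have h := left_alt_linearized x y x
  rw [right_alt] at h
  have h' : (x * y) * x + y * (x * x) = x * (y * x) + y * (x * x) := h
  exact add_right_cancel h'

theorem associator_swap_left (x y z : B) : associator x y z = - associator y x z := by
  have h := left_alt_linearized x y z
  rw [associator_apply, associator_apply, eq_neg_iff_add_eq_zero]
  rw [← sub_eq_zero] at h
  rw [← h]; abel

theorem associator_swap_right (x y z : B) : associator x y z = - associator x z y := by
  have h := right_alt_linearized y z x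
  rw [associator_apply, associator_apply, eq_neg_iff_add_eq_zero]
  rw [← sub_eq_zero] at h
  rw [← h]; abel

theorem associator_cyclic (x y z : B) : associator x y z = associator y z x := by
  rw [associator_swap_left, associator_swap_right, neg_neg]

/-- The defect is a sum of two associators; skew symmetry brings z to the front of both, and they
then combine into z times a vanishing sum. -/
theorem moufang_left (x y z : B) : z * (x * (z * y)) = ((z * x) * z) * y := by
  have e1 : ((z * x) * z) * y - z * (x * (z * y))
      = associator (z * x) z y + associator z x (z * y) := by
    simp only [associator_apply]; abel
  -- After the swaps, left alternativity replaces z(zx) by z²x, and linearized right alternativity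
  -- with z² on the left cancels the remaining terms.
  have e2 : associator (z * x) z y + associator z x (z * y)
      = z * (associator z x y + associator z y x) := by
    rw [associator_swap_left (z * x) z y, associator_swap_right z x (z * y)]
    simp only [associator_apply, ← left_alt]
    have h := right_alt_linearized x y (z * z)
    simp only [mul_add, mul_sub, ← left_alt]
    have h0 : z * z * x * y + z * z * y * x - (z * z * (x * y) + z * z * (y * x)) = 0 := by
      rw [h, sub_self]
    rw [← sub_eq_zero, ← neg_eq_zero, ← h0]
    abel
  have e3 : associator z x y + associator z y x = 0 := by
    rw [associator_swap_right z x y, neg_add_cancel]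
  rw [e3, mul_zero] at e2
  rw [e2] at e1
  exact (sub_eq_zero.1 e1).symm

theorem moufang_right (x y z : B) : x * (z * (y * z)) = ((x * z) * y) * z := by
  have h := congrArg unop (moufang_left (op y) (op x) (op z))
  simp only [unop_mul, unop_op] at h
  exact h.symm

/-- The defect is [z,x,yz] - z[x,y,z]; the left Moufang identity pulls z out of the first
associator, and cyclicity makes the two terms equal. -/
theorem moufang_middle' (x y z : B) : (z * x) * (y * z) = z * ((x * y) * z) := by
  have e1 : (z * x) * (y * z) - z * ((x * y) * z)
      = associator z x (y * z) - z * associator x y z := by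
    simp only [associator_apply, mul_sub]; abel
  have e2 : associator z x (y * z) = z * associator y z x := by
    rw [associator_swap_right, associator_apply, ← flexible, ← moufang_left, associator_apply,
      mul_sub]
    abel
  rw [e2, associator_cyclic x y z, sub_self] at e1
  exact sub_eq_zero.1 e1

theorem moufang_middle (x y z : B) : (z * x) * (y * z) = (z * (x * y)) * z := by
  rw [moufang_middle', flexible]

/-! ### Cancellation of elements with scalar product -/

section Scalars

variable {K : Type*} [Field K] [Module K B] [IsScalarTower K B B] [SMulCommClass K B B]

/-- Linearized alternativity controls only the sum a(bx) + b(ax). Multiplying it by a gives a(a(bx))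
= c·ax, and evaluating b(a²(bx)) by the Moufang identity then isolates b(ax), up to the factor c
that is cancelled. -/
theorem mul_mul_cancel_left_of_scalar {a b : B} {c : K} (hc : c ≠ 0) (hab : a * b = c • (1 : B))
    (hba : b * a = c • (1 : B)) (x : B) : b * (a * x) = c • x := by
  have h1 : a * (b * (a * x)) = c • (a * x) := by
    rw [moufang_left, hab, smul_mul_assoc, one_mul, smul_mul_assoc]
  have h2 : a * (b * x) + b * (a * x) = c • x + c • x := by
    rw [← left_alt_linearized, hab, hba]; simp
  have h3 : a * (a * (b * x)) = c • (a * x) := by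
    have h := congrArg (a * ·) h2
    simp only [mul_add, h1, mul_smul_comm] at h
    exact add_right_cancel h
  have h4 : b * (a * (a * (b * x))) = c • c • x := by
    rw [← left_alt a, moufang_left, ← right_alt, hba]
    simp only [smul_mul_assoc, one_mul, hab]
  rw [h3, mul_smul_comm] at h4
  exact smul_right_injective B hc h4

theorem mul_mul_cancel_right_of_scalar {a b : B} {c : K} (hc : c ≠ 0) (hab : a * b = c • (1 : B))
    (hba : b * a = c • (1 : B)) (x : B) : (x * a) * b = c • x := by
  have h := congrArg unop (mul_mul_cancel_left_of_scalar (B := Bᵐᵒᵖ) (K := K) (a := op a)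
    (b := op b) hc (unop_injective (by simpa using hba)) (unop_injective (by simpa using hab))
    (op x))
  simpa using h

/-- This is the multiplicativity of the norm: applied to x, y and their conjugates it makes the
normal element of xy the product of the two scalars. -/
theorem mul_mul_mul_of_scalar {x x' y y' : B} {c d : K} (hc : c ≠ 0) (hd : d ≠ 0)
    (hx : x * x' = c • (1 : B)) (hx' : x' * x = c • (1 : B))
    (hy : y * y' = d • (1 : B)) (hy' : y' * y = d • (1 : B)) :
    (x * y) * (y' * x') = (c * d) • (1 : B) := by
  -- The argument (y'x')x' is chosen so that right multiplication by x returns c·y'x', while y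
  -- cancels y' in y'(x'x').
  have h := moufang_middle y ((y' * x') * x') x
  rw [mul_mul_cancel_right_of_scalar hc hx' hx, right_alt,
    mul_mul_cancel_left_of_scalar hd hy' hy, mul_smul_comm (s := d), ← right_alt, hx] at h
  apply smul_right_injective B hc
  simp only [mul_smul_comm, smul_mul_assoc, one_mul, hx'] at h ⊢
  rw [h]
  simp only [smul_smul]
  congr 1
  ring

end Scalars

end IsAlternativeRing

namespace SliceAlg

namespace Cplx

/-! ### The algebra structure of the complexification -/

section Ring

variable {A : Type*} [NonAssocRing A]

/-- The complexification as the product of two copies of the algebra. -/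
def equivProd (A : Type*) : Cplx A ≃ A × A where
  toFun w := (w.re, w.im)
  invFun p := ⟨p.1, p.2⟩
  left_inv _ := rfl
  right_inv _ := rfl

instance : AddCommGroup (Cplx A) := (equivProd A).addCommGroup

@[simp] theorem zero_re : (0 : Cplx A).re = 0 := rfl
@[simp] theorem zero_im : (0 : Cplx A).im = 0 := rfl
@[simp] theorem one_re : (1 : Cplx A).re = 1 := rfl
@[simp] theorem one_im : (1 : Cplx A).im = 0 := rfl
@[simp] theorem add_re (v w : Cplx A) : (v + w).re = v.re + w.re := rfl
@[simp] theorem add_im (v w : Cplx A) : (v + w).im = v.im + w.im := rfl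
@[simp] theorem neg_re (v : Cplx A) : (-v).re = -v.re := rfl
@[simp] theorem neg_im (v : Cplx A) : (-v).im = -v.im := rfl
@[simp] theorem sub_re (v w : Cplx A) : (v - w).re = v.re - w.re := rfl
@[simp] theorem sub_im (v w : Cplx A) : (v - w).im = v.im - w.im := rfl
@[simp] theorem mul_re (v w : Cplx A) : (v * w).re = v.re * w.re - v.im * w.im := rfl
@[simp] theorem mul_im (v w : Cplx A) : (v * w).im = v.re * w.im + v.im * w.re := rfl
@[simp] theorem bar_re (v : Cplx A) : v.bar.re = v.re := rfl
@[simp] theorem bar_im (v : Cplx A) : v.bar.im = -v.im := rfl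
@[simp] theorem const_re (a : A) : (const a).re = a := rfl
@[simp] theorem const_im (a : A) : (const a).im = 0 := rfl

instance : NonAssocRing (Cplx A) where
  left_distrib u v w := by ext <;> simp only [mul_re, mul_im, add_re, add_im, mul_add] <;> abel
  right_distrib u v w := by ext <;> simp only [mul_re, mul_im, add_re, add_im, add_mul] <;> abel
  zero_mul v := by ext <;> simp
  mul_zero v := by ext <;> simp
  one_mul v := by ext <;> simp
  mul_one v := by ext <;> simp

/-- The mixed terms in the real and imaginary components are governed by the linearized laws of A,
so alternativity survives the complexification. -/
instance [IsAlternativeRing A] : IsAlternativeRing (Cplx A) where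
  left_alt v w := by
    have h1 := IsAlternativeRing.left_alt v.re
    have h2 := IsAlternativeRing.left_alt v.im
    have h3 := fun x => eq_sub_of_add_eq (IsAlternativeRing.left_alt_linearized v.re v.im x)
    ext <;> simp only [mul_re, mul_im, mul_add, add_mul, mul_sub, sub_mul, h1, h2, h3] <;> abel
  right_alt v w := by
    have h1 := IsAlternativeRing.right_alt v.re
    have h2 := IsAlternativeRing.right_alt v.im
    have h3 := fun x => eq_sub_of_add_eq (IsAlternativeRing.right_alt_linearized v.re v.im x)
    ext <;> simp only [mul_re, mul_im, mul_add, add_mul, mul_sub, sub_mul, h1, h2, h3] <;> abel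

theorem bar_bar (v : Cplx A) : v.bar.bar = v := by ext <;> simp
theorem bar_mul (v w : Cplx A) : (v * w).bar = v.bar * w.bar := by
  ext <;> simp [add_comm]
theorem bar_add (v w : Cplx A) : (v + w).bar = v.bar + w.bar := by ext <;> simp [add_comm]
theorem bar_neg (v : Cplx A) : (-v).bar = -v.bar := by ext <;> simp
@[simp] theorem bar_zero : (0 : Cplx A).bar = 0 := by ext <;> simp
@[simp] theorem bar_one : (1 : Cplx A).bar = 1 := by ext <;> simp

section Star

variable [StarRing A]

@[simp] theorem star_re (v : Cplx A) : (star v).re = star v.re := rfl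
@[simp] theorem star_im (v : Cplx A) : (star v).im = star v.im := rfl

instance : StarRing (Cplx A) where
  star_involutive v := by ext <;> simp
  star_mul v w := by ext <;> simp [add_comm]
  star_add v w := by ext <;> simp

theorem bar_star (v : Cplx A) : (star v).bar = star v.bar := by ext <;> simp

end Star

section Module

variable [Module ℝ A]

instance : SMul ℂ (Cplx A) :=
  ⟨fun c w => ⟨c.re • w.re - c.im • w.im, c.re • w.im + c.im • w.re⟩⟩

@[simp] theorem smul_re (c : ℂ) (w : Cplx A) : (c • w).re = c.re • w.re - c.im • w.im := rfl
@[simp] theorem smul_im (c : ℂ) (w : Cplx A) : (c • w).im = c.re • w.im + c.im • w.re := rfl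

instance : Module ℂ (Cplx A) where
  one_smul w := by ext <;> simp
  mul_smul c d w := by
    ext <;> simp only [smul_re, smul_im, Complex.mul_re, Complex.mul_im] <;> module
  smul_zero c := by ext <;> simp
  smul_add c v w := by ext <;> simp only [smul_re, smul_im, add_re, add_im] <;> module
  add_smul c d w := by
    ext <;> simp only [smul_re, smul_im, add_re, add_im, Complex.add_re, Complex.add_im] <;> module
  zero_smul w := by ext <;> simp

@[simp] theorem rsmul_re (r : ℝ) (w : Cplx A) : (r • w).re = r • w.re := by
  change ((r : ℂ) • w).re = _
  rw [smul_re]; simp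
@[simp] theorem rsmul_im (r : ℝ) (w : Cplx A) : (r • w).im = r • w.im := by
  change ((r : ℂ) • w).im = _
  rw [smul_im]; simp

theorem bar_smul (c : ℂ) (v : Cplx A) : (c • v).bar = conj c • v.bar := by
  ext <;> simp [add_comm]

theorem star_csmul [StarRing A] [StarModule ℝ A] (c : ℂ) (v : Cplx A) :
    star (c • v) = c • star v := by
  ext <;> simp

instance [IsScalarTower ℝ A A] : IsScalarTower ℂ (Cplx A) (Cplx A) where
  smul_assoc c v w := by
    ext <;> simp only [smul_re, smul_im, smul_eq_mul, mul_re, mul_im, sub_mul, add_mul,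
      smul_mul_assoc] <;> module

instance [SMulCommClass ℝ A A] : SMulCommClass ℂ (Cplx A) (Cplx A) where
  smul_comm c v w := by
    ext <;> simp only [smul_re, smul_im, smul_eq_mul, mul_re, mul_im, mul_sub, mul_add,
      mul_smul_comm] <;> module

/-- ℝ_ℂ is the complex line through 1; this turns slice preserving functions into complex scalar
functions. -/
theorem isReal_iff (w : Cplx A) : w.IsReal ↔ ∃ c : ℂ, w = c • (1 : Cplx A) := by
  constructor
  · rintro ⟨⟨r, hr⟩, s, hs⟩
    exact ⟨⟨r, s⟩, by ext <;> simp [hr, hs]⟩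
  · rintro ⟨c, rfl⟩
    exact ⟨⟨c.re, by simp⟩, c.im, by simp⟩

end Module

end Ring

end Cplx

end SliceAlg

/-! ### Analytic functions as sums of power series -/

section PowerSeries

variable {E : Type*} [NormedAddCommGroup E] [NormedSpace ℂ E]

/-- Plain coefficient sequences are the form in which Laurent expansions of slice functions are
given and have to be produced. -/
theorem analyticAt_iff_exists_hasSum {f : ℂ → E} {z₀ : ℂ} :
    AnalyticAt ℂ f z₀ ↔
      ∃ c : ℕ → E, ∀ᶠ z in 𝓝 z₀, HasSum (fun n => (z - z₀) ^ n • c n) (f z) := by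
  constructor
  · rintro ⟨p, hp⟩
    exact ⟨p.coeff, hasFPowerSeriesAt_iff'.1 hp⟩
  · rintro ⟨c, hc⟩
    refine ⟨fun n => ContinuousMultilinearMap.mkPiRing ℂ (Fin n) (c n), hasFPowerSeriesAt_iff'.2 ?_⟩
    simpa [FormalMultilinearSeries.coeff] using hc

theorem hasSum_coeff_unique {f : ℂ → E} {z₀ : ℂ} {c d : ℕ → E}
    (hc : ∀ᶠ z in 𝓝 z₀, HasSum (fun n => (z - z₀) ^ n • c n) (f z))
    (hd : ∀ᶠ z in 𝓝 z₀, HasSum (fun n => (z - z₀) ^ n • d n) (f z)) : c = d := by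
  have key : ∀ e : ℕ → E, (∀ᶠ z in 𝓝 z₀, HasSum (fun n => (z - z₀) ^ n • e n) (f z)) →
      HasFPowerSeriesAt f (fun n => ContinuousMultilinearMap.mkPiRing ℂ (Fin n) (e n)) z₀ := by
    intro e he
    refine hasFPowerSeriesAt_iff'.2 ?_
    simpa [FormalMultilinearSeries.coeff] using he
  have h := (key c hc).eq_formalMultilinearSeries (key d hd)
  funext n
  have hn := congrArg (fun p => p.coeff n) h
  simpa [FormalMultilinearSeries.coeff] using hn

theorem tendsto_conj_nhdsNE (z : ℂ) : Tendsto (conj : ℂ → ℂ) (𝓝[≠] z) (𝓝[≠] (conj z)) := by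
  refine tendsto_nhdsWithin_iff.2 ⟨(Complex.continuous_conj.tendsto z).mono_left nhdsWithin_le_nhds,
    ?_⟩
  filter_upwards [self_mem_nhdsWithin] with w hw h
  exact hw (by simpa using congrArg conj h)

theorem tendsto_conj_nhds (z : ℂ) : Tendsto (conj : ℂ → ℂ) (𝓝 z) (𝓝 (conj z)) :=
  Complex.continuous_conj.tendsto z

end PowerSeries

namespace SliceAlg

namespace Cplx

variable {A : Type*} [NonAssocNormedRing A] [NormedSpace ℝ A] [FiniteDimensional ℝ A]

/-! ### The normed space structure of the complexification -/

variable (A) in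
/-- Complex coordinates on the complexification. -/
noncomputable def coords : Cplx A →ₗ[ℂ] (Fin (Module.finrank ℝ A) → ℂ) where
  toFun w i := ⟨(Module.finBasis ℝ A).repr w.re i, (Module.finBasis ℝ A).repr w.im i⟩
  map_add' v w := funext fun i => by apply Complex.ext <;> simp
  map_smul' c v := funext fun i => by apply Complex.ext <;> simp

theorem coords_injective : Function.Injective (coords A) := by
  intro v w h
  have h' : ∀ i, coords A v i = coords A w i := fun i => congrFun h i
  ext
  · refine (Module.finBasis ℝ A).repr.injective (Finsupp.ext fun i => ?_)
    exact congrArg Complex.re (h' i)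
  · refine (Module.finBasis ℝ A).repr.injective (Finsupp.ext fun i => ?_)
    exact congrArg Complex.im (h' i)

/-- The norm must be homogeneous over ℂ, so it is pulled back from complex coordinates. Its relation
to the norm of A is immaterial: in finite dimension all the structure maps are continuous. -/
noncomputable instance : NormedAddCommGroup (Cplx A) :=
  NormedAddCommGroup.induced (Cplx A) (Fin (Module.finrank ℝ A) → ℂ) (coords A) coords_injective

noncomputable instance : NormedSpace ℂ (Cplx A) :=
  NormedSpace.induced ℂ (Cplx A) (Fin (Module.finrank ℝ A) → ℂ) (coords A)

instance : FiniteDimensional ℂ (Cplx A) :=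
  Module.Finite.of_injective (coords A) coords_injective

instance : FiniteDimensional ℝ (Cplx A) := FiniteDimensional.complexToReal _

instance : CompleteSpace (Cplx A) := FiniteDimensional.complete ℂ _

/-! ### The structure maps as continuous linear maps -/

variable (A) in
/-- The real component. -/
noncomputable def reL : Cplx A →L[ℝ] A :=
  LinearMap.toContinuousLinearMap
    { toFun := Cplx.re, map_add' := fun _ _ => rfl, map_smul' := fun r w => rsmul_re r w }

variable (A) in
/-- The imaginary component. -/
noncomputable def imL : Cplx A →L[ℝ] A :=
  LinearMap.toContinuousLinearMap
    { toFun := Cplx.im, map_add' := fun _ _ => rfl, map_smul' := fun r w => rsmul_im r w }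

variable (A) in
/-- The inclusion of the algebra in its complexification. -/
noncomputable def constL : A →L[ℝ] Cplx A :=
  LinearMap.toContinuousLinearMap
    { toFun := const
      map_add' := fun _ _ => by ext <;> simp
      map_smul' := fun r w => by ext <;> simp }

variable (A) in
/-- The complex conjugation. -/
noncomputable def barL : Cplx A →L[ℝ] Cplx A :=
  LinearMap.toContinuousLinearMap
    { toFun := bar, map_add' := bar_add, map_smul' := fun r w => by ext <;> simp }

variable (A) in
/-- The involution. -/
noncomputable def starL [StarRing A] [StarModule ℝ A] : Cplx A →L[ℂ] Cplx A :=
  LinearMap.toContinuousLinearMap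
    { toFun := star, map_add' := star_add, map_smul' := star_csmul }

variable (A) in
/-- The product. -/
noncomputable def mulL [IsScalarTower ℝ A A] [SMulCommClass ℝ A A] :
    Cplx A →L[ℂ] Cplx A →L[ℂ] Cplx A :=
  LinearMap.toContinuousBilinearMap (LinearMap.mul ℂ (Cplx A))

/-- The map `x + ι y ↦ x + J y`. -/
noncomputable def sliceL [IsScalarTower ℝ A A] [SMulCommClass ℝ A A] (J : A) : Cplx A →L[ℝ] A :=
  LinearMap.toContinuousLinearMap
    { toFun := slice J
      map_add' := fun v w => by simp only [slice, add_re, add_im, mul_add]; abel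
      map_smul' := fun r w => by simp [slice, mul_smul_comm] }

@[simp] theorem reL_apply (w : Cplx A) : reL A w = w.re := rfl
@[simp] theorem imL_apply (w : Cplx A) : imL A w = w.im := rfl
@[simp] theorem constL_apply (a : A) : constL A a = const a := rfl
@[simp] theorem barL_apply (w : Cplx A) : barL A w = w.bar := rfl
@[simp] theorem starL_apply [StarRing A] [StarModule ℝ A] (w : Cplx A) : starL A w = star w := rfl
@[simp] theorem mulL_apply [IsScalarTower ℝ A A] [SMulCommClass ℝ A A] (v w : Cplx A) :
    mulL A v w = v * w := rfl
@[simp] theorem sliceL_apply [IsScalarTower ℝ A A] [SMulCommClass ℝ A A] (J : A) (w : Cplx A) :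
    sliceL J w = w.slice J := rfl

theorem const_re_add_smul_const_im (w : Cplx A) : const w.re + Complex.I • const w.im = w := by
  ext <;> simp

/-! ### Meromorphy of products and conjugates -/

theorem analyticAt_mul [IsScalarTower ℝ A A] [SMulCommClass ℝ A A] {F G : ℂ → Cplx A} {z : ℂ}
    (hF : AnalyticAt ℂ F z) (hG : AnalyticAt ℂ G z) : AnalyticAt ℂ (fun w => F w * G w) z :=
  ((mulL A).analyticAt_bilinear (F z, G z)).comp₂ hF hG

theorem meromorphicAt_mul [IsScalarTower ℝ A A] [SMulCommClass ℝ A A] {F G : ℂ → Cplx A} {z : ℂ}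
    (hF : MeromorphicAt F z) (hG : MeromorphicAt G z) :
    MeromorphicAt (fun w => F w * G w) z := by
  obtain ⟨n, hn⟩ := hF
  obtain ⟨m, hm⟩ := hG
  refine ⟨n + m, (analyticAt_mul hn hm).congr (Eventually.of_forall fun w => ?_)⟩
  simp only [smul_mul_assoc, mul_smul_comm, smul_smul, pow_add]
  rw [mul_comm]

theorem analyticAt_star [StarRing A] [StarModule ℝ A] {F : ℂ → Cplx A} {z : ℂ}
    (hF : AnalyticAt ℂ F z) : AnalyticAt ℂ (fun w => star (F w)) z :=
  ((starL A).analyticAt (F z)).comp hF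

theorem meromorphicAt_star [StarRing A] [StarModule ℝ A] {F : ℂ → Cplx A} {z : ℂ}
    (hF : MeromorphicAt F z) : MeromorphicAt (fun w => star (F w)) z := by
  obtain ⟨n, hn⟩ := hF
  refine ⟨n, (analyticAt_star hn).congr (Eventually.of_forall fun w => ?_)⟩
  simp [star_csmul]

/-- The conjugate `z ↦ bar (F (conj z))` of a function. -/
def conjStem (F : ℂ → Cplx A) (z : ℂ) : Cplx A := (F (conj z)).bar

/-- The two antilinear conjugations compensate: the power series of the conjugate has the barred
coefficients. -/
theorem analyticAt_conjStem {F : ℂ → Cplx A} {z : ℂ} (hF : AnalyticAt ℂ F (conj z)) :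
    AnalyticAt ℂ (conjStem F) z := by
  obtain ⟨c, hc⟩ := analyticAt_iff_exists_hasSum.1 hF
  refine analyticAt_iff_exists_hasSum.2 ⟨fun n => (c n).bar, ?_⟩
  filter_upwards [(tendsto_conj_nhds z).eventually hc] with w hw
  have h := (barL A).hasSum hw
  simpa [conjStem, bar_smul] using h

theorem meromorphicNFAt_conjStem {F : ℂ → Cplx A} {z : ℂ} (hF : MeromorphicNFAt F (conj z)) :
    MeromorphicNFAt (conjStem F) z := by
  rcases hF with h | ⟨n, g, hg, hg0, h⟩
  · left
    filter_upwards [(tendsto_conj_nhds z).eventually h] with w hw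
    simp [conjStem, hw]
  · refine Or.inr ⟨n, conjStem g, analyticAt_conjStem hg, fun h0 => hg0 ?_, ?_⟩
    · simpa [conjStem, bar_bar] using congrArg bar h0
    · filter_upwards [(tendsto_conj_nhds z).eventually h] with w hw
      simp [conjStem, hw, bar_smul]

end Cplx

/-! ### Holomorphic stem functions -/

section Holomorphic

variable {A : Type*} [NonAssocNormedRing A] [NormedSpace ℝ A] [FiniteDimensional ℝ A]

open Cplx

/-- The two equations of the stem function say that its real differential commutes with
multiplication by i. Conversely, complex differentiability on an open set already gives analyticity,
hence class C¹. -/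
theorem isHolomorphicStemOn_iff {D : Set ℂ} (hD : IsOpen D) {F : ℂ → Cplx A} :
    IsHolomorphicStemOn D F ↔ ∀ z ∈ D, AnalyticAt ℂ F z := by
  constructor
  · rintro ⟨h1, h2, h3⟩
    suffices h : DifferentiableOn ℂ F D from fun z hz => h.analyticAt (hD.mem_nhds hz)
    intro z hz
    refine DifferentiableAt.differentiableWithinAt ?_
    have d1 : DifferentiableAt ℝ (fun w => (F w).re) z :=
      (h1.contDiffAt (hD.mem_nhds hz)).differentiableAt one_ne_zero
    have d2 : DifferentiableAt ℝ (fun w => (F w).im) z :=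
      (h2.contDiffAt (hD.mem_nhds hz)).differentiableAt one_ne_zero
    have hF : F = fun w => constL A (F w).re + Complex.I • constL A (F w).im :=
      funext fun w => (const_re_add_smul_const_im _).symm
    have hder : HasFDerivAt F ((constL A).comp (fderiv ℝ (fun w => (F w).re) z)
        + Complex.I • (constL A).comp (fderiv ℝ (fun w => (F w).im) z)) z := by
      refine HasFDerivAt.congr_of_eventuallyEq ?_ (Eventually.of_forall fun w => congrFun hF w)
      exact ((constL A).hasFDerivAt.comp z d1.hasFDerivAt).add
        (((constL A).hasFDerivAt.comp z d2.hasFDerivAt).const_smul Complex.I)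
    refine (differentiableAt_iff_restrictScalars ℝ hder.differentiableAt).2 ?_
    set L := fderiv ℝ F z with hL
    have hLv : ∀ v, L v = ⟨fderiv ℝ (fun w => (F w).re) z v, fderiv ℝ (fun w => (F w).im) z v⟩ := by
      intro v
      rw [hL, hder.fderiv]
      ext <;> simp
    have hLI : L Complex.I = Complex.I • L 1 := by
      have e := h3 z hz
      rw [hLv, hLv]
      ext
      · simpa using eq_neg_of_add_eq_zero_right e.2
      · simpa using (sub_eq_zero.1 e.1).symm
    refine ⟨(ContinuousLinearMap.toSpanSingleton ℂ (L 1)), ?_⟩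
    refine ContinuousLinearMap.ext fun v => ?_
    have hv : v = v.re • (1 : ℂ) + v.im • Complex.I := by simp [Complex.re_add_im]
    have hLv' : L v = v.re • L 1 + v.im • L Complex.I := by
      conv_lhs => rw [hv]
      rw [map_add, map_smul, map_smul]
    rw [hLv', hLI]
    ext <;> simp [sub_eq_add_neg]
  · intro h
    have ha : ∀ z ∈ D, ContDiffAt ℝ 1 F z := fun z hz =>
      ((h z hz).contDiffAt (n := 1)).restrict_scalars ℝ
    refine ⟨fun z hz => ?_, fun z hz => ?_, fun z hz => ?_⟩
    · exact ((reL A).contDiff.contDiffAt.comp z (ha z hz)).contDiffWithinAt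
    · exact ((imL A).contDiff.contDiffAt.comp z (ha z hz)).contDiffWithinAt
    · have hd := (h z hz).differentiableAt.hasFDerivAt
      have hd' := hd.restrictScalars ℝ
      have e1 : fderiv ℝ (fun w => (F w).re) z = _ :=
        ((reL A).hasFDerivAt.comp z hd').fderiv
      have e2 : fderiv ℝ (fun w => (F w).im) z = _ :=
        ((imL A).hasFDerivAt.comp z hd').fderiv
      have hI : fderiv ℂ F z Complex.I = Complex.I • fderiv ℂ F z 1 := by
        rw [← map_smul]; simp
      rw [e1, e2]
      simp [hI]

end Holomorphic

end SliceAlg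

namespace SliceAlg

variable {A : Type*} [NonAssocNormedRing A] [NormedSpace ℝ A] [StarRing A]

/-! ### Imaginary units and slices -/

section Units

theorem star_of_mem_imUnits {J : A} (hJ : J ∈ imUnits A) : star J = -J :=
  eq_neg_of_add_eq_zero_right hJ.1

theorem mul_self_of_mem_imUnits {J : A} (hJ : J ∈ imUnits A) : J * J = -1 := by
  have h : J * star J = 1 := hJ.2
  rw [star_of_mem_imUnits hJ, mul_neg] at h
  rw [← h, neg_neg]

theorem neg_mem_imUnits {J : A} (hJ : J ∈ imUnits A) : -J ∈ imUnits A := by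
  constructor
  · simp [tr, star_of_mem_imUnits hJ]
  · simp [nm, star_of_mem_imUnits hJ, mul_self_of_mem_imUnits hJ]

instance [AlternativeStarAlgebra A] : IsAlternativeRing A where
  left_alt := AlternativeStarAlgebra.left_alternative
  right_alt := AlternativeStarAlgebra.right_alternative

theorem sliceEmb_neg (J : A) (z : ℂ) : sliceEmb (-J) z = sliceEmb J (conj z) := by
  simp [sliceEmb]

theorem sliceEmb_neg_conj (J : A) (z : ℂ) : sliceEmb (-J) (conj z) = sliceEmb J z := by
  simp [sliceEmb]

theorem sliceEmb_of_im_eq_zero (J J' : A) {z : ℂ} (hz : z.im = 0) :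
    sliceEmb J z = sliceEmb J' z := by
  simp [sliceEmb, hz]

theorem sliceEmb_sub (J : A) (z w : ℂ) : sliceEmb J z - sliceEmb J w = sliceEmb J (z - w) := by
  simp only [sliceEmb, Complex.sub_re, Complex.sub_im]
  module

theorem continuous_sliceEmb (J : A) : Continuous (sliceEmb J) := by
  unfold sliceEmb
  fun_prop

variable [StarModule ℝ A]

theorem star_sliceEmb {J : A} (hJ : J ∈ imUnits A) (z : ℂ) :
    star (sliceEmb J z) = sliceEmb J (conj z) := by
  simp [sliceEmb, star_of_mem_imUnits hJ]

theorem tr_sliceEmb {J : A} (hJ : J ∈ imUnits A) (z : ℂ) :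
    tr (sliceEmb J z) = (2 * z.re) • (1 : A) := by
  rw [tr, star_sliceEmb hJ]
  simp only [sliceEmb, Complex.conj_re, Complex.conj_im]
  module

theorem rePart_sliceEmb {J : A} (hJ : J ∈ imUnits A) (z : ℂ) :
    rePart (sliceEmb J z) = z.re • (1 : A) := by
  rw [rePart, tr_sliceEmb hJ, smul_smul]
  congr 1
  ring

theorem imPart_sliceEmb {J : A} (hJ : J ∈ imUnits A) (z : ℂ) :
    imPart (sliceEmb J z) = z.im • J := by
  rw [imPart, rePart_sliceEmb hJ, sliceEmb]
  module

variable [IsScalarTower ℝ A A] [SMulCommClass ℝ A A]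

theorem nm_sliceEmb {J : A} (hJ : J ∈ imUnits A) (z : ℂ) :
    nm (sliceEmb J z) = (‖z‖ ^ 2) • (1 : A) := by
  rw [nm, star_sliceEmb hJ, Complex.sq_norm, Complex.normSq_apply]
  simp only [sliceEmb, Complex.conj_re, Complex.conj_im, mul_add, add_mul, smul_mul_assoc,
    mul_smul_comm, one_mul, mul_one, mul_self_of_mem_imUnits hJ]
  module

theorem sliceEmb_mem_quadCone {J : A} (hJ : J ∈ imUnits A) (z : ℂ) : sliceEmb J z ∈ quadCone A := by
  by_cases hz : z.im = 0
  · exact Or.inl ⟨z.re, by simp [sliceEmb, hz]⟩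
  · refine Or.inr ⟨2 * z.re, ‖z‖ ^ 2, tr_sliceEmb hJ z, nm_sliceEmb hJ z, ?_⟩
    rw [Complex.sq_norm, Complex.normSq_apply]
    have := mul_self_pos.2 hz
    nlinarith

variable [AlternativeStarAlgebra A]

/-- A nonreal x in the cone satisfies x² - tx + n = 0 with negative discriminant; completing the
square yields the imaginary unit. -/
theorem exists_sliceEmb_eq {x : A} (hx : x ∈ quadCone A) :
    ∃ J ∈ imUnits A, ∃ z : ℂ, x = sliceEmb J z := by
  rcases hx with ⟨r, rfl⟩ | ⟨t, n, ht, hn, h⟩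
  · obtain ⟨J, hJ⟩ := AlternativeStarAlgebra.imUnits_nonempty (A := A)
    exact ⟨J, hJ, r, by simp [sliceEmb]⟩
  · set β := √(n - t ^ 2 / 4) with hβ
    have hβ2 : β ^ 2 = n - t ^ 2 / 4 := Real.sq_sqrt (by linarith)
    have hβ0 : β ≠ 0 := (Real.sqrt_pos.2 (by linarith)).ne'
    have hs : star x = t • (1 : A) - x := eq_sub_of_add_eq' ht
    have hxx : x * x = t • x - n • (1 : A) := by
      rw [← hn, nm, hs, mul_sub, mul_smul_comm, mul_one]; abel
    refine ⟨β⁻¹ • (x - (t / 2) • (1 : A)), ⟨?_, ?_⟩, ⟨t / 2, β⟩, ?_⟩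
    · rw [tr, star_smul, star_sub, star_smul, hs]
      simp only [star_trivial, star_one]
      module
    · rw [nm, star_smul, star_sub, star_smul, hs]
      simp only [star_trivial, star_one, smul_mul_assoc, mul_smul_comm, mul_sub, sub_mul, one_mul,
        mul_one, hxx]
      have : β⁻¹ * β⁻¹ * (n - t ^ 2 / 4) = 1 := by
        rw [← hβ2]; field_simp
      conv_rhs => rw [← one_smul ℝ (1 : A), ← this]
      module
    · simp only [sliceEmb]
      rw [smul_smul, mul_inv_cancel₀ hβ0]
      module

variable [Nontrivial A]

theorem norm_sliceEmb {J : A} (hJ : J ∈ imUnits A) (z : ℂ) : ‖sliceEmb J z‖ = ‖z‖ := by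
  have h := AlternativeStarAlgebra.norm_sq_eq _ (sliceEmb_mem_quadCone hJ z)
  rw [nm_sliceEmb hJ] at h
  have h' := smul_left_injective ℝ (one_ne_zero (α := A)) h
  exact ((sq_eq_sq₀ (norm_nonneg _) (norm_nonneg _)).1 h').symm

theorem norm_eq_one_of_mem_imUnits {J : A} (hJ : J ∈ imUnits A) : ‖J‖ = 1 := by
  have h := norm_sliceEmb hJ Complex.I
  simpa [sliceEmb] using h

/-- The real part and the norm of the imaginary part determine z up to conjugation. The ambiguity is
the pair (z, J), (conj z, -J), together with the freedom of J at real points. -/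
theorem sliceEmb_eq_iff {J J' : A} (hJ : J ∈ imUnits A) (hJ' : J' ∈ imUnits A) {z z' : ℂ}
    (h : sliceEmb J' z' = sliceEmb J z) :
    (z' = z ∧ (z.im = 0 ∨ J' = J)) ∨ (z' = conj z ∧ J' = -J) := by
  have hre : z'.re = z.re := by
    have h1 := congrArg rePart h
    rw [rePart_sliceEmb hJ, rePart_sliceEmb hJ'] at h1
    exact smul_left_injective ℝ (one_ne_zero (α := A)) h1
  have him : z'.im • J' = z.im • J := by
    rw [← imPart_sliceEmb hJ, ← imPart_sliceEmb hJ', h]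
  have habs : |z'.im| = |z.im| := by
    have h2 := congrArg norm him
    simpa [norm_smul, norm_eq_one_of_mem_imUnits hJ, norm_eq_one_of_mem_imUnits hJ'] using h2
  by_cases hz : z.im = 0
  · have hz' : z'.im = 0 := by simpa [hz] using habs
    exact Or.inl ⟨Complex.ext hre (by rw [hz, hz']), Or.inl hz⟩
  rcases abs_eq_abs.1 habs with e | e
  · rw [e] at him
    exact Or.inl ⟨Complex.ext hre e, Or.inr (smul_right_injective A hz him)⟩
  · rw [e, neg_smul, ← smul_neg] at him
    refine Or.inr ⟨Complex.ext hre (by simpa using e), ?_⟩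
    rw [← smul_right_injective A hz him, neg_neg]

end Units

/-! ### Circular sets -/

section Circular

variable [StarModule ℝ A] [IsScalarTower ℝ A A] [SMulCommClass ℝ A A]

theorem conj_mem_profile {Ω : Set A} {z : ℂ} (hz : z ∈ profile Ω) : conj z ∈ profile Ω := by
  obtain ⟨J, hJ, h⟩ := hz
  exact ⟨-J, neg_mem_imUnits hJ, by rwa [sliceEmb_neg_conj]⟩

theorem isOpen_profile {Ω : Set A} (h : IsOpenInCone Ω) : IsOpen (profile Ω) := by
  obtain ⟨U, hU, rfl⟩ := h
  have : profile (U ∩ quadCone A) = ⋃ J ∈ imUnits A, sliceEmb J ⁻¹' U := by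
    ext z
    simp only [profile, Set.mem_ofPred_eq, Set.mem_iUnion, Set.mem_preimage, exists_prop]
    exact ⟨fun ⟨J, hJ, h⟩ => ⟨J, hJ, h.1⟩, fun ⟨J, hJ, h⟩ => ⟨J, hJ, h, sliceEmb_mem_quadCone hJ z⟩⟩
  rw [this]
  exact isOpen_biUnion fun J _ => hU.preimage (continuous_sliceEmb J)

theorem sliceEmb_mem_circularization {D : Set ℂ} {z : ℂ} (hz : z ∈ D) {J : A}
    (hJ : J ∈ imUnits A) : sliceEmb J z ∈ circularization A D :=
  ⟨sliceEmb_mem_quadCone hJ z, z, hz, J, hJ, rfl⟩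

variable [AlternativeStarAlgebra A] [Nontrivial A]

theorem profile_circularization {D : Set ℂ} (hD : ∀ z ∈ D, conj z ∈ D) :
    profile (circularization A D) = D := by
  ext z
  constructor
  · rintro ⟨J, hJ, -, w, hw, J', hJ', h⟩
    rcases sliceEmb_eq_iff hJ' hJ h with ⟨rfl, -⟩ | ⟨rfl, -⟩
    exacts [hw, hD _ hw]
  · intro hz
    obtain ⟨J, hJ⟩ := AlternativeStarAlgebra.imUnits_nonempty (A := A)
    exact ⟨J, hJ, sliceEmb_mem_circularization hz hJ⟩

theorem IsCircular.sliceEmb_mem_iff {Ω : Set A} (h : IsCircular Ω) {z : ℂ} {J : A}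
    (hJ : J ∈ imUnits A) : sliceEmb J z ∈ Ω ↔ z ∈ profile Ω := by
  constructor
  · exact fun hz => ⟨J, hJ, hz⟩
  · rintro ⟨J', hJ', hz⟩
    obtain ⟨E, rfl⟩ := h
    obtain ⟨-, w, hw, K, hK, h⟩ := hz
    rcases sliceEmb_eq_iff hK hJ' h with ⟨rfl, -⟩ | ⟨rfl, -⟩
    · exact sliceEmb_mem_circularization hw hJ
    · rw [← sliceEmb_neg]
      exact sliceEmb_mem_circularization hw (neg_mem_imUnits hJ)

theorem IsCircular.exists_sliceEmb_eq {Ω : Set A} (h : IsCircular Ω) {x : A} (hx : x ∈ Ω) :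
    ∃ z ∈ profile Ω, ∃ J ∈ imUnits A, x = sliceEmb J z := by
  obtain ⟨E, rfl⟩ := h
  obtain ⟨-, w, hw, K, hK, rfl⟩ := hx
  exact ⟨w, ⟨K, hK, sliceEmb_mem_circularization hw hK⟩, K, hK, rfl⟩

theorem IsCircular.circularization_profile {Ω : Set A} (h : IsCircular Ω) :
    circularization A (profile Ω) = Ω := by
  ext x
  constructor
  · rintro ⟨-, w, hw, K, hK, rfl⟩
    exact (h.sliceEmb_mem_iff hK).2 hw
  · intro hx
    obtain ⟨z, hz, J, hJ, rfl⟩ := h.exists_sliceEmb_eq hx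
    exact sliceEmb_mem_circularization hz hJ

variable [FiniteDimensional ℝ A]

theorem isOpenInCone_circularization {D : Set ℂ} (hD : ∀ z ∈ D, conj z ∈ D) (hDo : IsOpen D) :
    IsOpenInCone (circularization A D) := by
  obtain ⟨φ, hφ⟩ := SeparatingDual.exists_eq_one (R := ℝ) (one_ne_zero (α := A))
  have hstar : Continuous (star : A → A) :=
    (starLinearEquiv ℝ (A := A)).toLinearMap.continuous_of_finiteDimensional
  have hre : Continuous (rePart : A → A) := by
    unfold rePart tr
    fun_prop
  have him : Continuous (imPart : A → A) := by
    unfold imPart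
    fun_prop
  -- A continuous map on all of A that recovers z from α + βJ up to conjugation; φ reads off the
  -- real part because φ(1) = 1.
  let ψ : A → ℂ := fun x => (φ (rePart x) : ℂ) + (‖imPart x‖ : ℂ) * Complex.I
  have hψ : Continuous ψ := by
    fun_prop
  have hψs : ∀ J ∈ imUnits A, ∀ z : ℂ, ψ (sliceEmb J z) = z ∨ ψ (sliceEmb J z) = conj z := by
    intro J hJ z
    have h1 : ψ (sliceEmb J z) = ⟨z.re, |z.im|⟩ := by
      simp only [ψ, rePart_sliceEmb hJ, imPart_sliceEmb hJ, map_smul, hφ, norm_smul,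
        norm_eq_one_of_mem_imUnits hJ]
      apply Complex.ext <;> simp
    rw [h1]
    rcases abs_choice z.im with h | h
    · left; rw [h]
    · right; rw [h]; rfl
  refine ⟨ψ ⁻¹' D, hDo.preimage hψ, ?_⟩
  ext x
  constructor
  · rintro ⟨hx, z, hz, J, hJ, rfl⟩
    refine ⟨?_, hx⟩
    rcases hψs J hJ z with h | h
    · simpa [h] using hz
    · simpa [h] using hD z hz
  · rintro ⟨hx, hxQ⟩
    obtain ⟨J, hJ, z, rfl⟩ := SliceAlg.exists_sliceEmb_eq hxQ
    refine sliceEmb_mem_circularization ?_ hJ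
    rcases hψs J hJ z with h | h
    · simpa [h] using hx
    · simpa [h] using hD _ hx

end Circular

/-! ### Small shells -/

section Shell

variable [StarModule ℝ A] [IsScalarTower ℝ A A] [SMulCommClass ℝ A A]

theorem sameSlice_sliceEmb {J : A} (hJ : J ∈ imUnits A) (z w : ℂ) :
    SameSlice (sliceEmb J z) (sliceEmb J w) := ⟨J, hJ, ⟨z, rfl⟩, ⟨w, rfl⟩⟩

variable [AlternativeStarAlgebra A] [Nontrivial A]

theorem sliceEmb_mem_sigmaShell {J : A} (hJ : J ∈ imUnits A) {z ζ : ℂ} {R : ℝ} (hz : z ≠ ζ)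
    (hR : ‖z - ζ‖ < R) : sliceEmb J z ∈ sigmaShell (sliceEmb J ζ) 0 R := by
  have h := sameSlice_sliceEmb hJ z ζ
  refine ⟨sliceEmb_mem_quadCone hJ z, ?_, ?_⟩
  · rw [tauDist, if_pos h, sliceEmb_sub, norm_sliceEmb hJ]
    exact norm_pos_iff.2 (sub_ne_zero.2 hz)
  · rwa [sigmaDist, if_pos h, sliceEmb_sub, norm_sliceEmb hJ]

/-- A real centre lies in every slice. Around a nonreal centre, the distance σ to a point of another
slice is at least |Im ζ|, so a shell of radius at most |Im ζ| stays inside one slice plane. -/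
theorem of_sliceEmb_mem_sigmaShell {J J₀ : A} (hJ : J ∈ imUnits A) (hJ₀ : J₀ ∈ imUnits A)
    {z ζ : ℂ} {R : ℝ} (hR : ζ.im = 0 ∨ R ≤ |ζ.im|)
    (h : sliceEmb J z ∈ sigmaShell (sliceEmb J₀ ζ) 0 R) :
    ∃ ζ', sliceEmb J₀ ζ = sliceEmb J ζ' ∧ z ≠ ζ' ∧ ‖z - ζ'‖ < R := by
  obtain ⟨-, hτ, hσ⟩ := h
  by_cases hs : SameSlice (sliceEmb J z) (sliceEmb J₀ ζ)
  · rw [tauDist, if_pos hs] at hτ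
    rw [sigmaDist, if_pos hs] at hσ
    have key : ∀ ζ', sliceEmb J₀ ζ = sliceEmb J ζ' →
        ∃ ζ', sliceEmb J₀ ζ = sliceEmb J ζ' ∧ z ≠ ζ' ∧ ‖z - ζ'‖ < R := by
      intro ζ' h'
      rw [h', sliceEmb_sub, norm_sliceEmb hJ] at hτ hσ
      exact ⟨ζ', h', sub_ne_zero.1 (norm_pos_iff.1 hτ), hσ⟩
    obtain ⟨J', hJ', ⟨z', hz'⟩, w', hw'⟩ := hs
    rcases sliceEmb_eq_iff hJ hJ' hz' with ⟨rfl, hz | rfl⟩ | ⟨rfl, rfl⟩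
    · rcases hR with hR | hR
      · exact key ζ (sliceEmb_of_im_eq_zero _ _ hR)
      -- A real point belongs to all slices, but its distance from the centre is at least |Im ζ|,
      -- which the radius does not exceed.
      · rw [sliceEmb_of_im_eq_zero J J' hz, ← hw', sliceEmb_sub, norm_sliceEmb hJ'] at hσ
        have h1 := Complex.abs_im_le_norm (z' - w')
        have h2 : |w'.im| = |ζ.im| := by
          rcases sliceEmb_eq_iff hJ₀ hJ' hw' with ⟨rfl, -⟩ | ⟨rfl, -⟩ <;> simp
        rw [Complex.sub_im, hz, zero_sub, abs_neg, h2] at h1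
        linarith
    · exact key w' hw'.symm
    · exact key (conj w') (by rw [← hw', sliceEmb_neg])
  · exfalso
    rcases hR with hR | hR
    · rw [sliceEmb_of_im_eq_zero J₀ J hR] at hs
      exact hs (sameSlice_sliceEmb hJ z ζ)
    · rw [sigmaDist, if_neg hs, imPart_sliceEmb hJ₀, norm_smul, norm_eq_one_of_mem_imUnits hJ₀,
        mul_one, Real.norm_eq_abs] at hσ
      have h1 : |ζ.im| ≤ √(‖rePart (sliceEmb J z) - rePart (sliceEmb J₀ ζ)‖ ^ 2
          + (‖imPart (sliceEmb J z)‖ + |ζ.im|) ^ 2) := by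
        apply Real.le_sqrt_of_sq_le
        have := norm_nonneg (imPart (sliceEmb J z))
        have := abs_nonneg ζ.im
        nlinarith [sq_nonneg ‖rePart (sliceEmb J z) - rePart (sliceEmb J₀ ζ)‖]
      linarith

end Shell

end SliceAlg

namespace SliceAlg

namespace Cplx

variable {A : Type*} [NonAssocNormedRing A] [NormedSpace ℝ A] [StarRing A] [StarModule ℝ A]
  [IsScalarTower ℝ A A] [SMulCommClass ℝ A A]

/-! ### The idempotents attached to an imaginary unit -/

/-- The idempotent `(1 - ι J) / 2`. -/
noncomputable def idem (J : A) : Cplx A := ⟨(1 / 2 : ℝ) • (1 : A), -(1 / 2 : ℝ) • J⟩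

/-- The multiplication of `a` by the element of `ℂ_J` corresponding to `c`. -/
noncomputable def sliceSmul (J : A) (c : ℂ) (a : A) : A := c.re • a + c.im • (J * a)

theorem sliceSmul_neg_conj (J : A) (c : ℂ) (a : A) :
    sliceSmul (-J) (conj c) a = sliceSmul J c a := by
  simp [sliceSmul]

@[simp] theorem sliceSmul_zero (J : A) (c : ℂ) : sliceSmul J c 0 = 0 := by
  simp [sliceSmul]

theorem idem_add_idem_neg (J : A) : idem J + idem (-J) = 1 := by
  ext
  · simp only [idem, add_re, one_re]; module
  · simp only [idem, add_im, one_im]; module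

theorem slice_bar (J : A) (v : Cplx A) : v.bar.slice J = v.slice (-J) := by
  simp [slice]

theorem slice_add (J : A) (v w : Cplx A) : (v + w).slice J = v.slice J + w.slice J := by
  simp only [slice, add_re, add_im, mul_add]; abel

/-- The element `s e + t e'`, where `e` and `e'` are the idempotents attached to `J` and `-J`. -/
noncomputable def pair (J : A) (s t : ℂ) : Cplx A := s • idem J + t • idem (-J)

theorem pair_one (J : A) : pair J 1 1 = 1 := by
  simp [pair, idem_add_idem_neg]

/-- In the decomposition by the two idempotents the stem function of x - y is diagonal, so its slice
powers can be taken entrywise. -/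
theorem sub_sliceEmb_eq_pair (J : A) (z ζ : ℂ) :
    (⟨z.re • (1 : A) - sliceEmb J ζ, z.im • (1 : A)⟩ : Cplx A) = pair J (z - ζ) (z - conj ζ) := by
  ext
  · simp only [pair, idem, sliceEmb, add_re, smul_re, Complex.sub_re, Complex.sub_im,
      Complex.conj_re, Complex.conj_im]
    module
  · simp only [pair, idem, add_im, smul_im, Complex.sub_re, Complex.sub_im,
      Complex.conj_re, Complex.conj_im]
    module

variable {J : A}

theorem idem_mul_idem (hJ : J ∈ imUnits A) : idem J * idem J = idem J := by
  ext
  · simp only [idem, mul_re, smul_mul_assoc, mul_smul_comm, mul_self_of_mem_imUnits hJ, mul_one]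
    module
  · simp only [idem, mul_im, smul_mul_assoc, mul_smul_comm, mul_one, one_mul]
    module

theorem idem_mul_idem_neg (hJ : J ∈ imUnits A) : idem J * idem (-J) = 0 := by
  ext
  · simp only [idem, mul_re, smul_mul_assoc, mul_smul_comm, mul_neg, mul_self_of_mem_imUnits hJ,
      mul_one, zero_re]
    module
  · simp only [idem, mul_im, smul_mul_assoc, mul_smul_comm, mul_one, one_mul, zero_im]
    module

theorem pair_mul_pair (hJ : J ∈ imUnits A) (s t s' t' : ℂ) :
    pair J s t * pair J s' t' = pair J (s * s') (t * t') := by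
  have h1 := idem_mul_idem_neg hJ
  have h2 := idem_mul_idem_neg (neg_mem_imUnits hJ)
  rw [neg_neg] at h2
  simp only [pair, mul_add, add_mul, smul_mul_assoc, mul_smul_comm, idem_mul_idem hJ,
    idem_mul_idem (neg_mem_imUnits hJ), h1, h2, smul_zero, smul_smul, add_zero, zero_add]
  rw [mul_comm s', mul_comm t']

theorem npowRec_pair (hJ : J ∈ imUnits A) (s t : ℂ) (n : ℕ) :
    npowRec n (pair J s t) = pair J (s ^ n) (t ^ n) := by
  induction n with
  | zero => simp [npowRec, pair_one]
  | succ n ih => rw [npowRec, ih, pair_mul_pair hJ, pow_succ, pow_succ]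

theorem slice_smul [IsAlternativeRing A] (hJ : J ∈ imUnits A) (c : ℂ) (v : Cplx A) :
    (c • v).slice J = sliceSmul J c (v.slice J) := by
  have h : J * (J * v.im) = -v.im := by
    rw [← IsAlternativeRing.left_alt, mul_self_of_mem_imUnits hJ, neg_mul, one_mul]
  simp only [slice, sliceSmul, smul_re, smul_im, mul_add, mul_smul_comm, h]
  module

theorem slice_idem_mul [IsAlternativeRing A] (hJ : J ∈ imUnits A) (v : Cplx A) :
    (idem J * v).slice J = v.slice J := by
  have h (x : A) : J * (J * x) = -x := by
    rw [← IsAlternativeRing.left_alt, mul_self_of_mem_imUnits hJ, neg_mul, one_mul]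
  simp only [slice, idem, mul_re, mul_im, mul_add, mul_smul_comm, smul_mul_assoc, h, one_mul]
  module

theorem slice_idem_neg_mul [IsAlternativeRing A] (hJ : J ∈ imUnits A) (v : Cplx A) :
    (idem (-J) * v).slice J = 0 := by
  have h (x : A) : J * (J * x) = -x := by
    rw [← IsAlternativeRing.left_alt, mul_self_of_mem_imUnits hJ, neg_mul, one_mul]
  simp only [slice, idem, mul_re, mul_im, mul_add, mul_smul_comm, smul_mul_assoc, h, one_mul,
    neg_mul, mul_neg]
  module

/-- The value on the slice of J retains exactly the component of v along the idempotent; adding the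
components for J and -J recovers v. -/
theorem idem_mul_const_slice [IsAlternativeRing A] (hJ : J ∈ imUnits A) (v : Cplx A) :
    idem J * const (v.slice J) = idem J * v := by
  have h (x : A) : J * (J * x) = -x := by
    rw [← IsAlternativeRing.left_alt, mul_self_of_mem_imUnits hJ, neg_mul, one_mul]
  ext
  · simp only [slice, idem, mul_re, const_re, const_im, mul_add, smul_mul_assoc, one_mul, mul_zero]
    module
  · simp only [slice, idem, mul_im, const_re, const_im, mul_add, smul_mul_assoc, one_mul, h,
      mul_zero]
    module

theorem idem_mul_const_sliceSmul [IsAlternativeRing A] (hJ : J ∈ imUnits A) (c : ℂ) (a : A) :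
    idem J * const (sliceSmul J c a) = c • (idem J * const a) := by
  have h : a = (const a).slice J := by simp [slice]
  conv_lhs => rw [h, ← slice_smul hJ, idem_mul_const_slice hJ, mul_smul_comm]

theorem inverse_pair [IsAlternativeRing A] (hJ : J ∈ imUnits A) {s t : ℂ} (hs : s ≠ 0)
    (ht : t ≠ 0) : (pair J s t).inverse = pair J s⁻¹ t⁻¹ := by
  have h1 : pair J s t * pair J s⁻¹ t⁻¹ = 1 := by
    rw [pair_mul_pair hJ, mul_inv_cancel₀ hs, mul_inv_cancel₀ ht, pair_one]
  have h2 : pair J s⁻¹ t⁻¹ * pair J s t = 1 := by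
    rw [pair_mul_pair hJ, inv_mul_cancel₀ hs, inv_mul_cancel₀ ht, pair_one]
  have hex : ∃ v : Cplx A, pair J s t * v = 1 ∧ v * pair J s t = 1 := ⟨_, h1, h2⟩
  rw [inverse, dif_pos hex]
  -- Associativity being unavailable, the chosen inverse is identified with the explicit one through
  -- the cancellation law.
  have h3 := IsAlternativeRing.mul_mul_cancel_left_of_scalar (K := ℂ) one_ne_zero
    (h1.trans (one_smul ℂ _).symm) (h2.trans (one_smul ℂ _).symm) hex.choose
  rw [hex.choose_spec.1, mul_one, one_smul] at h3
  exact h3.symm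

theorem zpow_pair [IsAlternativeRing A] (hJ : J ∈ imUnits A) {s t : ℂ} (hs : s ≠ 0)
    (ht : t ≠ 0) (n : ℤ) : (pair J s t).zpow n = pair J (s ^ n) (t ^ n) := by
  cases n with
  | ofNat n => simp [zpow, npowRec_pair hJ]
  | negSucc n =>
    rw [zpow, inverse_pair hJ hs ht, npowRec_pair hJ, zpow_negSucc, zpow_negSucc, inv_pow, inv_pow]

theorem slice_pair_mul_const [IsAlternativeRing A] (hJ : J ∈ imUnits A) (s t : ℂ) (a : A) :
    (pair J s t * const a).slice J = sliceSmul J s a := by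
  rw [pair, add_mul, slice_add, smul_mul_assoc, smul_mul_assoc, slice_smul hJ, slice_smul hJ,
    slice_idem_mul hJ, slice_idem_neg_mul hJ]
  simp [slice]

end Cplx

open Cplx

variable {A : Type*} [NonAssocNormedRing A] [NormedSpace ℝ A] [StarRing A] [StarModule ℝ A]
  [IsScalarTower ℝ A A] [SMulCommClass ℝ A A]

/-- Only the entry z - ζ is visible on the slice of J. The condition z ≠ conj ζ is still needed:
there the other entry vanishes, and negative powers would take the default value of a missing
inverse. -/
theorem slice_laurentStem [IsAlternativeRing A] {J : A} (hJ : J ∈ imUnits A) {z ζ : ℂ}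
    (h1 : z ≠ ζ) (h2 : z ≠ conj ζ) (a : A) (n : ℤ) :
    (laurentStem (sliceEmb J ζ) a n z).slice J = sliceSmul J ((z - ζ) ^ n) a := by
  rw [laurentStem, sub_sliceEmb_eq_pair, zpow_pair hJ (sub_ne_zero.2 h1) (sub_ne_zero.2 h2),
    slice_pair_mul_const hJ]

/-! ### Poles and meromorphy -/

section Poles

variable [FiniteDimensional ℝ A] [AlternativeStarAlgebra A] [Nontrivial A]

theorem eventually_ne_conj (ζ : ℂ) : ∀ᶠ z in 𝓝[≠] ζ, z ≠ ζ ∧ z ≠ conj ζ := by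
  have h1 : ∀ᶠ z in 𝓝[≠] ζ, z ≠ ζ := self_mem_nhdsWithin
  by_cases h : conj ζ = ζ
  · simpa [h] using h1
  · have h2 : ∀ᶠ z in 𝓝[≠] ζ, z ≠ conj ζ :=
      (eventually_ne_nhds (Ne.symm h)).filter_mono nhdsWithin_le_nhds
    exact h1.and h2

/-- Multiplication by the idempotent turns the left action of ℂ_J on the coefficients into complex
scalar multiplication. The slice expansion becomes a vector-valued Laurent series with finite
principal part. -/
theorem IsPole.meromorphicAt {Ω : Set A} {f : A → A} {J : A} (hJ : J ∈ imUnits A) {ζ : ℂ}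
    (h : IsPole Ω f (sliceEmb J ζ)) :
    MeromorphicAt (fun z => idem J * const (f (sliceEmb J z))) ζ := by
  obtain ⟨-, R, hR, -, a, ha, m, hm⟩ := h
  set c : ℤ → Cplx A := fun n => idem J * const (a n) with hc
  have hc0 : ∀ n : ℤ, n < -(m : ℤ) → c n = 0 := by
    intro n hn
    obtain ⟨k, rfl⟩ : ∃ k : ℕ, n = -(k : ℤ) := ⟨n.natAbs, by omega⟩
    have : const (0 : A) = 0 := rfl
    rw [hc]
    simp only [hm k (by omega), this, mul_zero]
  have hsum : ∀ᶠ z in 𝓝[≠] ζ, HasSum (fun k : ℕ => (z - ζ) ^ k • c (k - m))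
      ((z - ζ) ^ m • (idem J * const (f (sliceEmb J z)))) := by
    have hball : ∀ᶠ z in 𝓝[≠] ζ, ‖z - ζ‖ < R := by
      refine Filter.Eventually.filter_mono nhdsWithin_le_nhds ?_
      filter_upwards [Metric.ball_mem_nhds ζ hR] with z hz
      rwa [← dist_eq_norm]
    filter_upwards [eventually_ne_conj ζ, hball] with z hz hzR
    have h1 := ha z J hJ (sliceEmb_mem_sigmaShell hJ hz.1 hzR)
    simp only [slice_laurentStem hJ hz.1 hz.2] at h1
    have h2 := (((mulL A (idem J)).restrictScalars ℝ).comp (constL A)).hasSum h1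
    simp only [ContinuousLinearMap.comp_apply, ContinuousLinearMap.coe_restrictScalars', mulL_apply,
      constL_apply] at h2
    simp only [idem_mul_const_sliceSmul hJ] at h2
    have h3 := h2.const_smul ((z - ζ) ^ m)
    have hinj : Function.Injective (fun k : ℕ => (k : ℤ) - m) := fun i j hij => by
      simpa using hij
    rw [← hinj.hasSum_iff] at h3
    · convert h3 using 2 with k
      rw [Function.comp_apply, smul_smul, ← zpow_natCast, ← zpow_natCast,
        ← zpow_add₀ (sub_ne_zero.2 hz.1), add_sub_cancel]
    · intro n hn
      have : n < -(m : ℤ) := by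
        by_contra! hlt
        exact hn ⟨(n + m).toNat, by simp only; omega⟩
      have h0 := hc0 n this
      simp only [hc] at h0
      rw [h0, smul_zero, smul_zero]
  classical
  -- The value at ζ is reset to the constant term of the shifted series; the original value there is
  -- arbitrary.
  let g : ℂ → Cplx A := Function.update
    (fun z => (z - ζ) ^ m • (idem J * const (f (sliceEmb J z)))) ζ (c (-m))
  have hg : AnalyticAt ℂ g ζ := by
    refine analyticAt_iff_exists_hasSum.2 ⟨fun k => c (k - m), ?_⟩
    rw [eventually_nhdsWithin_iff] at hsum
    filter_upwards [hsum] with z hz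
    by_cases hzζ : z = ζ
    · subst hzζ
      have := hasSum_single (f := fun k : ℕ => (z - z) ^ k • c (k - m)) 0
        (fun k hk => by simp [hk])
      simpa [g] using this
    · simpa [g, hzζ] using hz hzζ
  refine MeromorphicAt.iff_eventuallyEq_zpow_smul_analyticAt.2 ⟨-m, g, hg, ?_⟩
  filter_upwards [self_mem_nhdsWithin] with z hz
  have hz' : z ≠ ζ := hz
  simp only [g, Function.update_of_ne hz', smul_smul]
  rw [← zpow_natCast, ← zpow_add₀ (sub_ne_zero.2 hz')]
  simp

theorem isPole_of_hasSum {Ω : Set A} {f : A → A} {y : A} (hy : y ∈ quadCone A) (a : ℤ → A) {r : ℝ}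
    (hr : 0 < r) (ha : ∃ m : ℕ, ∀ k : ℕ, m < k → a (-(k : ℤ)) = 0)
    (h : ∀ J ∈ imUnits A, ∀ ζ z : ℂ, y = sliceEmb J ζ → z ≠ ζ → ‖z - ζ‖ < r →
      sliceEmb J z ∈ Ω ∧ HasSum (fun n : ℤ => sliceSmul J ((z - ζ) ^ n) (a n)) (f (sliceEmb J z))) :
    IsPole Ω f y := by
  refine ⟨hy, ?_⟩
  obtain ⟨J₀, hJ₀, ζ, rfl⟩ := exists_sliceEmb_eq hy
  -- Shrinking the radius to at most |Im ζ| confines the shell of a nonreal centre to its own slice.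
  obtain ⟨R, hR0, hRr, hR⟩ : ∃ R, 0 < R ∧ R ≤ r ∧ (ζ.im = 0 ∨ R ≤ |ζ.im|) := by
    by_cases hζ : ζ.im = 0
    · exact ⟨r, hr, le_rfl, Or.inl hζ⟩
    · exact ⟨min r |ζ.im|, lt_min hr (abs_pos.2 hζ), min_le_left _ _, Or.inr (min_le_right _ _)⟩
  refine ⟨R, hR0, ?_, a, ?_, ha⟩
  · intro x hx
    obtain ⟨J, hJ, z, rfl⟩ := exists_sliceEmb_eq hx.1
    obtain ⟨ζ', h1, h2, h3⟩ := of_sliceEmb_mem_sigmaShell hJ hJ₀ hR hx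
    exact (h J hJ ζ' z h1 h2 (h3.trans_le hRr)).1
  · intro z J hJ hx
    obtain ⟨ζ', h1, h2, h3⟩ := of_sliceEmb_mem_sigmaShell hJ hJ₀ hR hx
    -- The two conjugate points are 2|Im ζ'| apart, beyond the radius, unless they coincide with the
    -- excluded centre.
    have h4 : z ≠ conj ζ' := by
      rintro rfl
      have him : ζ'.im = 0 ∨ R ≤ |ζ'.im| := by
        rcases sliceEmb_eq_iff hJ hJ₀ h1 with ⟨rfl, -⟩ | ⟨rfl, -⟩
        · exact hR
        · simpa using hR
      rcases him with him | him
      · exact h2 (Complex.conj_eq_iff_im.2 him)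
      · have h5 := Complex.abs_im_le_norm (conj ζ' - ζ')
        simp only [Complex.sub_im, Complex.conj_im] at h5
        have h6 : |-ζ'.im - ζ'.im| = 2 * |ζ'.im| := by
          rw [← abs_neg, show -(-ζ'.im - ζ'.im) = 2 * ζ'.im by ring, abs_mul]; simp
        rw [h6] at h5
        linarith
    rw [h1]
    simp only [slice_laurentStem hJ h2 h4]
    exact (h J hJ ζ' z h1 h2 (h3.trans_le hRr)).2

theorem hasSum_sliceSmul {J : A} (hJ : J ∈ imUnits A) {w : ℂ} (hw : w ≠ 0) {c : ℕ → Cplx A}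
    {v : Cplx A} (h : HasSum (fun k : ℕ => w ^ k • c k) v) (N : ℤ) :
    HasSum (fun n : ℤ => sliceSmul J (w ^ n) (if N ≤ n then (c (n - N).toNat).slice J else 0))
      ((w ^ N • v).slice J) := by
  have hinj : Function.Injective (fun k : ℕ => (k : ℤ) + N) := fun i j hij => by simpa using hij
  rw [← hinj.hasSum_iff]
  · have h1 := (sliceL J).hasSum (h.const_smul (w ^ N))
    have e : ∀ k : ℕ, ((fun n : ℤ => sliceSmul J (w ^ n)
        (if N ≤ n then (c (n - N).toNat).slice J else 0)) ∘ fun k : ℕ => (k : ℤ) + N) k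
        = sliceL J (w ^ N • w ^ k • c k) := by
      intro k
      simp only [Function.comp_apply, sliceL_apply, smul_smul]
      rw [slice_smul hJ, ← zpow_natCast, ← zpow_add₀ hw, add_comm N]
      simp
    rw [funext e]
    exact h1
  · intro n hn
    have : ¬ N ≤ n := fun hle => hn ⟨(n - N).toNat, by simp only; omega⟩
    simp [this]

/-- The coefficients are those of the Laurent series of F, evaluated on the slice of the centre.
They must serve every slice through the centre: for a real centre the symmetry of F makes them
independent of J, for a nonreal one only the presentations (ζ, J₀) and (conj ζ, -J₀) occur. -/
theorem isPole_of_meromorphicAt {Ω : Set A} {f : A → A} {J₀ : A} (hJ₀ : J₀ ∈ imUnits A) {ζ : ℂ}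
    {F : ℂ → Cplx A} (hF : MeromorphicAt F ζ) (hsymm : ∀ z, F (conj z) = (F z).bar)
    (h : ∀ᶠ z in 𝓝[≠] ζ, ∀ J ∈ imUnits A, sliceEmb J z ∈ Ω ∧ f (sliceEmb J z) = (F z).slice J) :
    IsPole Ω f (sliceEmb J₀ ζ) := by
  obtain ⟨N, g, hg, hFg⟩ := MeromorphicAt.iff_eventuallyEq_zpow_smul_analyticAt.1 hF
  obtain ⟨c, hc⟩ := analyticAt_iff_exists_hasSum.1 hg
  have hev := (h.and hFg).and (hc.filter_mono nhdsWithin_le_nhds)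
  obtain ⟨r, hr, hball⟩ := Metric.eventually_nhds_iff.1 (eventually_nhdsWithin_iff.1 hev)
  have hlocal : ∀ J ∈ imUnits A, ∀ z, z ≠ ζ → ‖z - ζ‖ < r → sliceEmb J z ∈ Ω ∧
      HasSum (fun n : ℤ => sliceSmul J ((z - ζ) ^ n)
        (if N ≤ n then (c (n - N).toNat).slice J else 0)) (f (sliceEmb J z)) := by
    intro J hJ z hz hzr
    obtain ⟨⟨h1, h2⟩, h3⟩ := hball (by rwa [dist_eq_norm]) hz
    refine ⟨(h1 J hJ).1, ?_⟩
    rw [(h1 J hJ).2, h2]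
    exact hasSum_sliceSmul hJ (sub_ne_zero.2 hz) h3 N
  refine isPole_of_hasSum (sliceEmb_mem_quadCone hJ₀ ζ)
    (fun n => if N ≤ n then (c (n - N).toNat).slice J₀ else 0) hr
    ⟨(-N).toNat, fun k hk => if_neg (by omega)⟩ ?_
  intro J hJ ζ' z hy hz hzr
  by_cases hζ : ζ.im = 0
  · have hζc : conj ζ = ζ := Complex.conj_eq_iff_im.2 hζ
    have hgs : conjStem g =ᶠ[𝓝[≠] ζ] g := by
      have h2 : ∀ᶠ z in 𝓝[≠] ζ, F (conj z) = (conj z - ζ) ^ N • g (conj z) := by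
        have := tendsto_conj_nhdsNE ζ
        rw [hζc] at this
        exact this.eventually hFg
      filter_upwards [hFg, h2, self_mem_nhdsWithin] with z h3 h4 h5
      rw [hsymm, h3] at h4
      have h6 := congrArg bar h4
      rw [bar_bar, bar_smul] at h6
      have h7 : conj ((conj z - ζ) ^ N) = (z - ζ) ^ N := by
        rw [map_zpow₀, map_sub, Complex.conj_conj, hζc]
      rw [h7] at h6
      exact (smul_right_injective _ (zpow_ne_zero N (sub_ne_zero.2 h5)) h6).symm
    have hgs' : conjStem g =ᶠ[𝓝 ζ] g :=
      (ContinuousAt.eventuallyEq_nhds_iff_eventuallyEq_nhdsNE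
        (analyticAt_conjStem (by rwa [hζc])).continuousAt hg.continuousAt).1 hgs
    -- Both sequences are power series coefficients of g at a real centre, because g inherits the
    -- symmetry of F. Their ι-components therefore vanish.
    have hcs : (fun n => (c n).bar) = c := by
      refine hasSum_coeff_unique (f := g) (z₀ := ζ) ?_ hc
      have h2 : ∀ᶠ z in 𝓝 ζ, HasSum (fun n => (conj z - ζ) ^ n • c n) (g (conj z)) := by
        have := tendsto_conj_nhds ζ
        rw [hζc] at this
        exact this.eventually hc
      filter_upwards [h2, hgs'] with z h3 h4
      have h5 := (barL A).hasSum h3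
      rw [← h4]
      simpa [conjStem, bar_smul, Function.comp_def, hζc] using h5
    have hci : ∀ n, (c n).im = 0 := by
      intro n
      have h2 := congrArg Cplx.im (congrFun hcs n)
      rw [bar_im] at h2
      have h3 : (2 : ℝ) • (c n).im = 0 := by
        rw [two_smul]
        exact eq_neg_iff_add_eq_zero.1 h2.symm
      exact (smul_eq_zero.1 h3).resolve_left two_ne_zero
    have hζ' : ζ' = ζ := by
      rcases sliceEmb_eq_iff hJ₀ hJ hy.symm with ⟨rfl, -⟩ | ⟨rfl, -⟩
      exacts [rfl, hζc]
    subst hζ'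
    have hs : ∀ n, (c n).slice J₀ = (c n).slice J := fun n => by simp [slice, hci]
    simpa only [hs] using hlocal J hJ z hz hzr
  · rcases sliceEmb_eq_iff hJ₀ hJ hy.symm with ⟨rfl, h1 | rfl⟩ | ⟨rfl, rfl⟩
    · exact absurd h1 hζ
    · exact hlocal J hJ z hz hzr
    -- The centre is now presented through -J₀, and conjugation carries the expansion over with the
    -- same coefficients.
    · have hz' : conj z ≠ ζ := fun h' => hz (by rw [← h', Complex.conj_conj])
      have hzr' : ‖conj z - ζ‖ < r := by
        rw [← Complex.norm_conj, map_sub, Complex.conj_conj]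
        exact hzr
      have h2 := hlocal J₀ hJ₀ (conj z) hz' hzr'
      rw [sliceEmb_neg]
      refine ⟨h2.1, ?_⟩
      have h3 : ∀ (n : ℤ) (a : A), sliceSmul (-J₀) ((z - conj ζ) ^ n) a
          = sliceSmul J₀ ((conj z - ζ) ^ n) a := by
        intro n a
        rw [← sliceSmul_neg_conj J₀, map_zpow₀, map_sub, Complex.conj_conj]
      simpa only [h3] using h2.2

end Poles

end SliceAlg

/-! ### Codiscrete sets and meromorphic normal forms -/

theorem eventually_codiscreteWithin_iff {D : Set ℂ} (hD : IsOpen D) {P : ℂ → Prop} :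
    (∀ᶠ z in codiscreteWithin D, P z) ↔ ∀ x ∈ D, ∀ᶠ z in 𝓝[≠] x, P z := by
  rw [Filter.Eventually, mem_codiscreteWithin_iff_forall_mem_nhdsNE]
  refine forall₂_congr fun x hx => ⟨fun h => ?_, fun h => mem_of_superset h Set.subset_union_left⟩
  filter_upwards [h, mem_nhdsWithin_of_mem_nhds (hD.mem_nhds hx)] with z hz hzD
  exact hz.resolve_right fun h' => h' hzD

theorem eventuallyEq_nhds_of_meromorphicNFAt {E : Type*} [NormedAddCommGroup E] [NormedSpace ℂ E]
    {F G : ℂ → E} {z : ℂ} (hF : MeromorphicNFAt F z) (hG : MeromorphicNFAt G z)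
    (h : F =ᶠ[𝓝[≠] z] G) : F =ᶠ[𝓝 z] G :=
  (hF.eventuallyEq_nhdsNE_iff_eventuallyEq_nhds hG).1 h

namespace SliceAlg

open Cplx

variable {A : Type*} [NonAssocNormedRing A] [NormedSpace ℝ A] [StarRing A] [StarModule ℝ A]
  [IsScalarTower ℝ A A] [SMulCommClass ℝ A A] [AlternativeStarAlgebra A]

/-! ### The stem function of a slice function -/

variable (A) in
/-- A fixed imaginary unit. -/
noncomputable def unit : A := (AlternativeStarAlgebra.imUnits_nonempty (A := A)).choose

theorem unit_mem : unit A ∈ imUnits A :=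
  (AlternativeStarAlgebra.imUnits_nonempty (A := A)).choose_spec

/-- The stem function recovered from the values on the slice of the fixed imaginary unit. -/
noncomputable def stemOf (f : A → A) (z : ℂ) : Cplx A :=
  idem (unit A) * const (f (sliceEmb (unit A) z)) +
    idem (-unit A) * const (f (sliceEmb (-unit A) z))

theorem stemOf_eq_of_slice {f : A → A} {z : ℂ} {v : Cplx A}
    (h : ∀ J ∈ imUnits A, f (sliceEmb J z) = v.slice J) : stemOf f z = v := by
  rw [stemOf, h _ unit_mem, h _ (neg_mem_imUnits unit_mem), idem_mul_const_slice unit_mem,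
    idem_mul_const_slice (neg_mem_imUnits unit_mem), ← add_mul, idem_add_idem_neg, one_mul]

theorem Induces.stemOf_eq {D : Set ℂ} {F : ℂ → Cplx A} {f : A → A} (h : Induces D F f) {z : ℂ}
    (hz : z ∈ D) : stemOf f z = F z :=
  stemOf_eq_of_slice (h z hz)

/-- The symmetry holds for an arbitrary f, since conjugating z exchanges the roles of the unit and
its negative. -/
theorem conjStem_stemOf (f : A → A) : conjStem (stemOf f) = stemOf f := by
  funext z
  have h1 : ∀ J : A, (idem J).bar = idem (-J) := fun J => by ext <;> simp [idem]
  have h2 : ∀ a : A, (const a).bar = const a := fun a => by ext <;> simp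
  simp only [conjStem, stemOf, bar_add, bar_mul, h1, h2, neg_neg, ← sliceEmb_neg]
  rw [add_comm]

/-- This makes `sliceFun` independent of the chosen presentation. At real points the symmetry kills
the ι-component, so the unit does not matter. -/
theorem slice_eq_of_sliceEmb_eq [Nontrivial A] {F : ℂ → Cplx A} (hF : conjStem F = F) {J J' : A}
    (hJ : J ∈ imUnits A) (hJ' : J' ∈ imUnits A) {z z' : ℂ} (h : sliceEmb J' z' = sliceEmb J z) :
    (F z').slice J' = (F z).slice J := by
  have hs : ∀ w, F (conj w) = (F w).bar := fun w => by
    conv_rhs => rw [← hF]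
    simp [conjStem, bar_bar]
  rcases sliceEmb_eq_iff hJ hJ' h with ⟨rfl, hz | rfl⟩ | ⟨rfl, rfl⟩
  · have h1 := congrArg Cplx.im (hs z')
    rw [Complex.conj_eq_iff_im.2 hz, bar_im] at h1
    have h2 : (2 : ℝ) • (F z').im = 0 := by
      rw [two_smul]
      exact eq_neg_iff_add_eq_zero.1 h1
    simp [slice, (smul_eq_zero.1 h2).resolve_left two_ne_zero]
  · rfl
  · rw [hs, slice_bar, neg_neg]

open Classical in
/-- The function induced by a stem function on the circularization of `D`, and `0` elsewhere. -/
noncomputable def sliceFun (D : Set ℂ) (F : ℂ → Cplx A) (x : A) : A :=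
  if h : ∃ z ∈ D, ∃ J ∈ imUnits A, x = sliceEmb J z then
    (F h.choose).slice h.choose_spec.2.choose else 0

section

variable [Nontrivial A]

theorem sliceFun_sliceEmb {D : Set ℂ} {F : ℂ → Cplx A} (hF : conjStem F = F) {z : ℂ} (hz : z ∈ D)
    {J : A} (hJ : J ∈ imUnits A) : sliceFun D F (sliceEmb J z) = (F z).slice J := by
  have h : ∃ w ∈ D, ∃ K ∈ imUnits A, sliceEmb J z = sliceEmb K w := ⟨z, hz, J, hJ, rfl⟩
  rw [sliceFun, dif_pos h]
  exact slice_eq_of_sliceEmb_eq hF hJ h.choose_spec.2.choose_spec.1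
    h.choose_spec.2.choose_spec.2.symm

theorem sliceFun_of_notMem {D : Set ℂ} {F : ℂ → Cplx A} {x : A} (hx : x ∉ circularization A D) :
    sliceFun D F x = 0 := by
  rw [sliceFun, dif_neg]
  rintro ⟨z, hz, J, hJ, rfl⟩
  exact hx (sliceEmb_mem_circularization hz hJ)

theorem induces_sliceFun (D : Set ℂ) {F : ℂ → Cplx A} (hF : conjStem F = F) :
    Induces D F (sliceFun D F) := fun _ hz _ hJ => sliceFun_sliceEmb hF hz hJ

theorem isStemOn_of_conjStem_eq (D : Set ℂ) {F : ℂ → Cplx A} (hF : conjStem F = F) :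
    IsStemOn D F := fun z _ => by
  conv_rhs => rw [← hF]
  simp [conjStem, bar_bar]

variable [FiniteDimensional ℝ A]

theorem isSliceRegularOn_sliceFun {D : Set ℂ} (hD : ∀ z ∈ D, conj z ∈ D) (hDo : IsOpen D)
    {F : ℂ → Cplx A} (hF : conjStem F = F) (hFa : ∀ z ∈ D, AnalyticAt ℂ F z) :
    IsSliceRegularOn (circularization A D) (sliceFun D F) := by
  refine ⟨⟨D, rfl⟩, isOpenInCone_circularization hD hDo, F, ?_⟩
  rw [profile_circularization hD]
  exact ⟨isStemOn_of_conjStem_eq D hF, induces_sliceFun D hF, (isHolomorphicStemOn_iff hDo).2 hFa⟩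

theorem IsSliceRegularOn.analyticAt_stemOf {Ω : Set A} {f : A → A} (h : IsSliceRegularOn Ω f)
    {z : ℂ} (hz : z ∈ profile Ω) : AnalyticAt ℂ (stemOf f) z := by
  obtain ⟨-, ho, F, -, hi, hh⟩ := h
  refine ((isHolomorphicStemOn_iff (isOpen_profile ho)).1 hh z hz).congr ?_
  filter_upwards [(isOpen_profile ho).mem_nhds hz] with w hw
  exact (hi.stemOf_eq hw).symm

theorem IsSliceRegularOn.apply_sliceEmb {Ω : Set A} {f : A → A} (h : IsSliceRegularOn Ω f)
    {z : ℂ} (hz : z ∈ profile Ω) {J : A} (hJ : J ∈ imUnits A) :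
    f (sliceEmb J z) = (stemOf f z).slice J := by
  obtain ⟨-, -, F, -, hi, -⟩ := h
  rw [hi.stemOf_eq hz, hi z hz J hJ]

/-! ### Normal forms of meromorphic stem functions -/

open Classical in
/-- The normal form on `D` of a meromorphic function, extended by `0`. -/
noncomputable def normalForm (D : Set ℂ) (F : ℂ → Cplx A) (z : ℂ) : Cplx A :=
  if z ∈ D then toMeromorphicNFOn F D z else 0

/-- The points of `D` where `F` is analytic. -/
def regularSet (D : Set ℂ) (F : ℂ → Cplx A) : Set ℂ := {z | z ∈ D ∧ AnalyticAt ℂ F z}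

variable {D : Set ℂ} {F : ℂ → Cplx A}

theorem isOpen_regularSet (hD : IsOpen D) : IsOpen (regularSet D F) :=
  hD.inter (isOpen_analyticAt ℂ F)

theorem conj_mem_regularSet (hD : ∀ z ∈ D, conj z ∈ D) (hF : conjStem F = F) :
    ∀ z ∈ regularSet D F, conj z ∈ regularSet D F := by
  rintro z ⟨h1, h2⟩
  refine ⟨hD z h1, ?_⟩
  rw [← hF]
  exact analyticAt_conjStem (by rwa [Complex.conj_conj])

theorem normalForm_eventuallyEq (hD : IsOpen D) {z : ℂ} (hz : z ∈ D) :
    normalForm D F =ᶠ[𝓝 z] toMeromorphicNFOn F D := by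
  filter_upwards [hD.mem_nhds hz] with w hw
  rw [normalForm, if_pos hw]

theorem meromorphicNFAt_normalForm (hD : IsOpen D) {z : ℂ} (hz : z ∈ D) :
    MeromorphicNFAt (normalForm D F) z :=
  (meromorphicNFAt_congr (normalForm_eventuallyEq hD hz)).2
    (meromorphicNFOn_toMeromorphicNFOn F D hz)

theorem normalForm_eventuallyEq_nhdsNE (hD : IsOpen D) (hF : MeromorphicOn F D) {z : ℂ}
    (hz : z ∈ D) : normalForm D F =ᶠ[𝓝[≠] z] F :=
  ((normalForm_eventuallyEq hD hz).filter_mono nhdsWithin_le_nhds).trans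
    (hF.toMeromorphicNFOn_eq_self_on_nhdsNE hz)

theorem normalForm_eventuallyEq_codiscreteWithin (hD : IsOpen D) (hF : MeromorphicOn F D) :
    normalForm D F =ᶠ[codiscreteWithin D] F :=
  (eventually_codiscreteWithin_iff hD).2 fun _ hz => normalForm_eventuallyEq_nhdsNE hD hF hz

theorem eventually_conj_codiscreteWithin (hD : IsOpen D) (hDc : ∀ z ∈ D, conj z ∈ D)
    {P : ℂ → Prop} (h : ∀ᶠ z in codiscreteWithin D, P z) :
    ∀ᶠ z in codiscreteWithin D, P (conj z) := by
  rw [eventually_codiscreteWithin_iff hD] at h ⊢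
  exact fun x hx => (tendsto_conj_nhdsNE x).eventually (h _ (hDc x hx))

/-- Symmetry off a discrete set suffices: the normal form and its conjugate are both in normal form,
and such functions coincide at a point once they agree on a punctured neighbourhood. -/
theorem conjStem_normalForm (hD : IsOpen D) (hDc : ∀ z ∈ D, conj z ∈ D) (hF : MeromorphicOn F D)
    (hs : conjStem F =ᶠ[codiscreteWithin D] F) : conjStem (normalForm D F) = normalForm D F := by
  funext z
  by_cases hz : z ∈ D
  · refine (eventuallyEq_nhds_of_meromorphicNFAt
      (meromorphicNFAt_conjStem (meromorphicNFAt_normalForm hD (hDc z hz)))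
      (meromorphicNFAt_normalForm hD hz) ?_).eq_of_nhds
    have h1 := (tendsto_conj_nhdsNE z).eventually
      (normalForm_eventuallyEq_nhdsNE hD hF (hDc z hz))
    filter_upwards [h1, (eventually_codiscreteWithin_iff hD).1 hs z hz,
      normalForm_eventuallyEq_nhdsNE hD hF hz] with w hw1 hw2 hw3
    rw [hw3, ← hw2, conjStem, hw1, conjStem]
  · have hz' : conj z ∉ D := fun h => hz (by simpa using hDc _ h)
    simp [conjStem, normalForm, hz, hz']

theorem eventually_mem_regularSet (hD : IsOpen D) {z : ℂ} (hz : z ∈ D) (hF : MeromorphicAt F z) :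
    ∀ᶠ w in 𝓝[≠] z, w ∈ regularSet D F := by
  filter_upwards [hF.eventually_analyticAt, mem_nhdsWithin_of_mem_nhds (hD.mem_nhds hz)]
    with w h1 h2
  exact ⟨h2, h1⟩

/-! ### Semiregular functions and meromorphic stem functions -/

variable {Ω : Set A}

/-- The semiregular function induced by a meromorphic stem function in normal form. -/
noncomputable def Semiregular.ofStem (hΩ : IsCircular Ω) (hΩo : IsOpenInCone Ω) (F : ℂ → Cplx A)
    (hF : ∀ z ∈ profile Ω, MeromorphicNFAt F z) (hs : conjStem F = F) : Semiregular Ω where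
  dom := circularization A (regularSet (profile Ω) F)
  toFun := sliceFun (regularSet (profile Ω) F) F
  semiregular := by
    have hc := conj_mem_regularSet (fun _ => conj_mem_profile (Ω := Ω)) hs
    refine ⟨?_, isSliceRegularOn_sliceFun hc (isOpen_regularSet (isOpen_profile hΩo)) hs
      fun z hz => hz.2, ?_⟩
    · rintro x ⟨-, z, hz, J, hJ, rfl⟩
      exact (hΩ.sliceEmb_mem_iff hJ).2 hz.1
    · rintro y ⟨hy, -⟩
      obtain ⟨ζ, hζ, J₀, hJ₀, rfl⟩ := hΩ.exists_sliceEmb_eq hy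
      refine Or.inl (isPole_of_meromorphicAt hJ₀ (hF ζ hζ).meromorphicAt
        (fun z => isStemOn_of_conjStem_eq Set.univ hs z trivial) ?_)
      filter_upwards [eventually_mem_regularSet (isOpen_profile hΩo) hζ (hF ζ hζ).meromorphicAt]
        with z hz J hJ
      exact ⟨sliceEmb_mem_circularization hz hJ, sliceFun_sliceEmb hs hz hJ⟩
  not_removable := by
    have hc := conj_mem_regularSet (fun _ => conj_mem_profile (Ω := Ω)) hs
    rintro y ⟨hy, hyd⟩ ⟨-, -, Ω₁, f₁, hsub, hy₁, hreg, heq⟩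
    obtain ⟨ζ, hζ, J₀, hJ₀, rfl⟩ := hΩ.exists_sliceEmb_eq hy
    refine hyd (sliceEmb_mem_circularization (D := regularSet (profile Ω) F) ⟨hζ, ?_⟩ hJ₀)
    -- A slice regular extension would have a stem function analytic at ζ agreeing with F nearby;
    -- since F is in normal form, F would be analytic at ζ as well.
    have ha : AnalyticAt ℂ (stemOf f₁) ζ := hreg.analyticAt_stemOf ⟨J₀, hJ₀, hy₁⟩
    refine ha.congr (eventuallyEq_nhds_of_meromorphicNFAt ha.meromorphicNFAt (hF ζ hζ) ?_)
    filter_upwards [eventually_mem_regularSet (isOpen_profile hΩo) hζ (hF ζ hζ).meromorphicAt]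
      with z hz
    refine stemOf_eq_of_slice fun J hJ => ?_
    rw [heq (sliceEmb_mem_circularization hz hJ), sliceFun_sliceEmb hs hz hJ]
  eq_zero_off x hx := sliceFun_of_notMem hx

namespace Semiregular

/-- The stem function of a semiregular function, with value `0` at the poles and outside `Ω`. -/
noncomputable def stem (f : Semiregular Ω) : ℂ → Cplx A := stemOf f.toFun

variable (f : Semiregular Ω)

theorem isCircular_dom : IsCircular f.dom := f.semiregular.2.1.1

theorem profile_dom_subset : profile f.dom ⊆ profile Ω :=
  fun _ ⟨J, hJ, h⟩ => ⟨J, hJ, f.semiregular.1 h⟩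

theorem conjStem_stem : conjStem f.stem = f.stem := conjStem_stemOf _

theorem analyticAt_stem_of_mem {z : ℂ} (hz : z ∈ profile f.dom) : AnalyticAt ℂ f.stem z :=
  f.semiregular.2.1.analyticAt_stemOf hz

theorem apply_sliceEmb {z : ℂ} (hz : z ∈ profile f.dom) {J : A} (hJ : J ∈ imUnits A) :
    f.toFun (sliceEmb J z) = (f.stem z).slice J :=
  f.semiregular.2.1.apply_sliceEmb hz hJ

theorem induces_stem {D : Set ℂ} (hD : D ⊆ profile f.dom) : Induces D f.stem f.toFun :=
  fun _ hz _ hJ => f.apply_sliceEmb (hD hz) hJ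

theorem isStemOn_stem (D : Set ℂ) : IsStemOn D f.stem :=
  isStemOn_of_conjStem_eq D f.conjStem_stem

theorem stem_of_notMem {z : ℂ} (hz : z ∉ profile f.dom) : f.stem z = 0 := by
  refine stemOf_eq_of_slice fun J hJ => ?_
  rw [f.eq_zero_off _ fun h => hz ⟨J, hJ, h⟩]
  simp [slice]

theorem isPole_of_notMem (hΩ : IsCircular Ω) {z : ℂ} (hz : z ∈ profile Ω)
    (hz' : z ∉ profile f.dom) {J : A} (hJ : J ∈ imUnits A) :
    IsPole f.dom f.toFun (sliceEmb J z) := by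
  have hy : sliceEmb J z ∈ Ω \ f.dom := ⟨(hΩ.sliceEmb_mem_iff hJ).2 hz, fun h => hz' ⟨J, hJ, h⟩⟩
  exact (f.semiregular.2.2 _ hy).resolve_right (f.not_removable _ hy)

/-- At a pole, the two idempotent components of the stem function are meromorphic separately, by the
expansions on the slices of the unit and of its negative. -/
theorem meromorphicOn_stem (hΩ : IsCircular Ω) : MeromorphicOn f.stem (profile Ω) := by
  intro z hz
  by_cases hz' : z ∈ profile f.dom
  · exact (f.analyticAt_stem_of_mem hz').meromorphicAt
  · exact ((f.isPole_of_notMem hΩ hz hz' unit_mem).meromorphicAt unit_mem).add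
      ((f.isPole_of_notMem hΩ hz hz' (neg_mem_imUnits unit_mem)).meromorphicAt
        (neg_mem_imUnits unit_mem))

/-- The conventions match: maximality of the domain forbids analyticity at an omitted point, and at
a genuine pole the normal form takes the value 0, as does the stem function. Thus domain and values
are both determined by the germ. -/
theorem normalForm_stem (hΩ : IsCircular Ω) (hΩo : IsOpenInCone Ω) :
    (∀ z ∈ profile Ω, z ∉ profile f.dom → ¬ AnalyticAt ℂ (normalForm (profile Ω) f.stem) z) ∧
      normalForm (profile Ω) f.stem = f.stem := by
  set D := profile Ω
  have hD : IsOpen D := isOpen_profile hΩo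
  have hDc : ∀ z ∈ D, conj z ∈ D := fun _ => conj_mem_profile
  have hm := f.meromorphicOn_stem hΩ
  set F := normalForm D f.stem with hF
  have hs : conjStem F = F :=
    conjStem_normalForm hD hDc hm (by rw [f.conjStem_stem])
  have hreg : ∀ z ∈ profile f.dom, F =ᶠ[𝓝 z] f.stem := fun z hz =>
    eventuallyEq_nhds_of_meromorphicNFAt
      (meromorphicNFAt_normalForm hD (f.profile_dom_subset hz))
      (f.analyticAt_stem_of_mem hz).meromorphicNFAt
      (normalForm_eventuallyEq_nhdsNE hD hm (f.profile_dom_subset hz))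
  have hmem : ∀ z ∈ profile f.dom, z ∈ regularSet D F := fun z hz =>
    ⟨f.profile_dom_subset hz, (f.analyticAt_stem_of_mem hz).congr (hreg z hz).symm⟩
  have hna : ∀ z ∈ D, z ∉ profile f.dom → ¬ AnalyticAt ℂ F z := by
    intro z hz hz' ha
    -- If the normal form were analytic at z, the slice function it induces would remove the
    -- singularity.
    have hp := f.isPole_of_notMem hΩ hz hz' unit_mem
    refine f.not_removable (sliceEmb (unit A) z)
      ⟨(hΩ.sliceEmb_mem_iff unit_mem).2 hz, fun h => hz' ⟨_, unit_mem, h⟩⟩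
      ⟨hp.1, ?_, circularization A (regularSet D F), sliceFun (regularSet D F) F, ?_,
        sliceEmb_mem_circularization (D := regularSet D F) ⟨hz, ha⟩ unit_mem,
        isSliceRegularOn_sliceFun (conj_mem_regularSet hDc hs) (isOpen_regularSet hD) hs
          fun z hz => hz.2, ?_⟩
    · obtain ⟨-, R, hR, h, -⟩ := hp
      exact ⟨R, hR, h⟩
    · intro x hx
      obtain ⟨w, hw, J, hJ, rfl⟩ := f.isCircular_dom.exists_sliceEmb_eq hx
      exact sliceEmb_mem_circularization (hmem w hw) hJ
    · intro x hx
      obtain ⟨w, hw, J, hJ, rfl⟩ := f.isCircular_dom.exists_sliceEmb_eq hx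
      rw [sliceFun_sliceEmb hs (hmem w hw) hJ, f.apply_sliceEmb hw hJ, (hreg w hw).eq_of_nhds]
  refine ⟨hna, funext fun z => ?_⟩
  by_cases hz : z ∈ D
  · by_cases hz' : z ∈ profile f.dom
    · exact (hreg z hz').eq_of_nhds
    · rw [f.stem_of_notMem hz']
      exact ((meromorphicNFAt_iff_analyticAt_or.1
        (meromorphicNFAt_normalForm hD hz)).resolve_left (hna z hz hz')).2.2
  · rw [f.stem_of_notMem fun h => hz (f.profile_dom_subset h), hF, normalForm, if_neg hz]

theorem meromorphicNFAt_stem (hΩ : IsCircular Ω) (hΩo : IsOpenInCone Ω) {z : ℂ}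
    (hz : z ∈ profile Ω) : MeromorphicNFAt f.stem z := by
  rw [← (f.normalForm_stem hΩ hΩo).2]
  exact meromorphicNFAt_normalForm (isOpen_profile hΩo) hz

theorem profile_dom_eq (hΩ : IsCircular Ω) (hΩo : IsOpenInCone Ω) :
    profile f.dom = regularSet (profile Ω) f.stem := by
  ext z
  refine ⟨fun hz => ⟨f.profile_dom_subset hz, f.analyticAt_stem_of_mem hz⟩, fun hz => ?_⟩
  by_contra hz'
  have h := f.normalForm_stem hΩ hΩo
  exact h.1 z hz.1 hz' (by rw [h.2]; exact hz.2)

theorem dom_eq (hΩ : IsCircular Ω) (hΩo : IsOpenInCone Ω) :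
    f.dom = circularization A (regularSet (profile Ω) f.stem) := by
  rw [← f.profile_dom_eq hΩ hΩo, f.isCircular_dom.circularization_profile]

theorem stem_injective (hΩ : IsCircular Ω) (hΩo : IsOpenInCone Ω) :
    Function.Injective (stem : Semiregular Ω → ℂ → Cplx A) := by
  intro f g h
  have hd : f.dom = g.dom := by rw [f.dom_eq hΩ hΩo, g.dom_eq hΩ hΩo, h]
  refine Semiregular.ext hd (funext fun x => ?_)
  by_cases hx : x ∈ f.dom
  · obtain ⟨z, hz, J, hJ, rfl⟩ := f.isCircular_dom.exists_sliceEmb_eq hx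
    rw [f.apply_sliceEmb hz hJ, g.apply_sliceEmb (hd ▸ hz) hJ, h]
  · rw [f.eq_zero_off x hx, g.eq_zero_off x (hd ▸ hx)]

theorem stem_eq_of_eventuallyEq (hΩ : IsCircular Ω) (hΩo : IsOpenInCone Ω) {G : ℂ → Cplx A}
    (h : f.stem =ᶠ[codiscreteWithin (profile Ω)] G) {z : ℂ} (hz : z ∈ profile Ω)
    (hG : MeromorphicNFAt G z) : f.stem =ᶠ[𝓝 z] G :=
  eventuallyEq_nhds_of_meromorphicNFAt (f.meromorphicNFAt_stem hΩ hΩo hz) hG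
    ((eventually_codiscreteWithin_iff (isOpen_profile hΩo)).1 h z hz)

theorem eq_of_stem_eventuallyEq (hΩ : IsCircular Ω) (hΩo : IsOpenInCone Ω) {f g : Semiregular Ω}
    (h : f.stem =ᶠ[codiscreteWithin (profile Ω)] g.stem) : f = g := by
  refine stem_injective hΩ hΩo (funext fun z => ?_)
  by_cases hz : z ∈ profile Ω
  · exact (f.stem_eq_of_eventuallyEq hΩ hΩo h hz (g.meromorphicNFAt_stem hΩ hΩo hz)).eq_of_nhds
  · rw [f.stem_of_notMem fun h => hz (f.profile_dom_subset h),
      g.stem_of_notMem fun h => hz (g.profile_dom_subset h)]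

theorem exists_stem_eventuallyEq (hΩ : IsCircular Ω) (hΩo : IsOpenInCone Ω) {F : ℂ → Cplx A}
    (hF : MeromorphicOn F (profile Ω)) (hs : conjStem F =ᶠ[codiscreteWithin (profile Ω)] F) :
    ∃ f : Semiregular Ω, f.stem =ᶠ[codiscreteWithin (profile Ω)] F := by
  have hD := isOpen_profile hΩo
  have hc := conjStem_normalForm hD (fun _ => conj_mem_profile) hF hs
  refine ⟨ofStem hΩ hΩo (normalForm (profile Ω) F)
    (fun z hz => meromorphicNFAt_normalForm hD hz) hc, ?_⟩
  refine EventuallyEq.trans ?_ (normalForm_eventuallyEq_codiscreteWithin hD hF)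
  refine (eventually_codiscreteWithin_iff hD).2 fun z hz => ?_
  filter_upwards [eventually_mem_regularSet hD hz
    (meromorphicNFAt_normalForm (F := F) hD hz).meromorphicAt] with w hw
  exact stemOf_eq_of_slice fun J hJ => sliceFun_sliceEmb hc hw hJ

end Semiregular

end

end SliceAlg

namespace SliceAlg

open Cplx

/-! ### The algebra of semiregular functions on a slice domain -/

namespace Semiregular

variable {A : Type*} [NonAssocNormedRing A] [NormedSpace ℝ A] [StarRing A] [StarModule ℝ A]
  [IsScalarTower ℝ A A] [SMulCommClass ℝ A A] [AlternativeStarAlgebra A] [Nontrivial A]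
  [FiniteDimensional ℝ A] {Ω : Set A} [hΩ : Fact (IsSliceDomain Ω)]

variable (Ω) in
/-- The filter of the codiscrete subsets of the profile of `Ω`. -/
noncomputable abbrev cod : Filter ℂ := codiscreteWithin (profile Ω)

variable (Ω) in
theorem isOpen_dom_profile : IsOpen (profile Ω) := isOpen_profile hΩ.out.2.1

theorem eq_of_stem {f g : Semiregular Ω} (h : f.stem =ᶠ[cod Ω] g.stem) : f = g :=
  eq_of_stem_eventuallyEq hΩ.out.1 hΩ.out.2.1 h

theorem meromorphic_stem (f : Semiregular Ω) : MeromorphicOn f.stem (profile Ω) :=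
  f.meromorphicOn_stem hΩ.out.1

theorem exists_stem {F : ℂ → Cplx A} (hF : MeromorphicOn F (profile Ω))
    (hs : conjStem F =ᶠ[cod Ω] F) : ∃ f : Semiregular Ω, f.stem =ᶠ[cod Ω] F :=
  exists_stem_eventuallyEq hΩ.out.1 hΩ.out.2.1 hF hs

theorem eventually_conj {P : ℂ → Prop} (h : ∀ᶠ z in cod Ω, P z) : ∀ᶠ z in cod Ω, P (conj z) :=
  eventually_conj_codiscreteWithin (isOpen_dom_profile Ω) (fun _ => conj_mem_profile) h

theorem stem_conj (f : Semiregular Ω) (z : ℂ) : f.stem (conj z) = (f.stem z).bar :=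
  isStemOn_of_conjStem_eq Set.univ f.conjStem_stem z trivial

instance : (cod Ω).NeBot := by
  obtain ⟨z, hz⟩ := hΩ.out.2.2.1.nonempty
  rw [← Filter.frequently_true_iff_neBot, Filter.Frequently,
    eventually_codiscreteWithin_iff (isOpen_dom_profile Ω)]
  intro h
  have := h z hz
  simp only [not_true, Filter.eventually_false_iff_eq_bot] at this
  exact NeBot.ne inferInstance this

variable (Ω) in
/-- The germs of the meromorphic stem functions. -/
noncomputable def stemRing : Subring (Germ (cod Ω) (Cplx A)) where
  carrier := {g | ∃ F : ℂ → Cplx A, MeromorphicOn F (profile Ω) ∧ conjStem F =ᶠ[cod Ω] F ∧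
    (F : Germ (cod Ω) (Cplx A)) = g}
  mul_mem' := by
    rintro _ _ ⟨F, hF, hFs, rfl⟩ ⟨G, hG, hGs, rfl⟩
    refine ⟨fun z => F z * G z, fun z hz => meromorphicAt_mul (hF z hz) (hG z hz), ?_, rfl⟩
    filter_upwards [hFs, hGs] with z h1 h2
    rw [← h1, ← h2]
    exact bar_mul _ _
  one_mem' := ⟨fun _ => 1, fun z _ => MeromorphicAt.const _ z,
    Eventually.of_forall fun z => bar_one, rfl⟩
  add_mem' := by
    rintro _ _ ⟨F, hF, hFs, rfl⟩ ⟨G, hG, hGs, rfl⟩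
    refine ⟨fun z => F z + G z, fun z hz => (hF z hz).add (hG z hz), ?_, rfl⟩
    filter_upwards [hFs, hGs] with z h1 h2
    rw [← h1, ← h2]
    exact bar_add _ _
  zero_mem' := ⟨fun _ => 0, fun z _ => MeromorphicAt.const _ z,
    Eventually.of_forall fun z => bar_zero, rfl⟩
  neg_mem' := by
    rintro _ ⟨F, hF, hFs, rfl⟩
    refine ⟨fun z => -F z, fun z hz => (hF z hz).neg, ?_, rfl⟩
    filter_upwards [hFs] with z h1
    rw [← h1]
    exact bar_neg _

variable (Ω) in
/-- A semiregular function is the same as the germ of a meromorphic stem function. -/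
noncomputable def equivStemRing : Semiregular Ω ≃ stemRing Ω :=
  Equiv.ofBijective (fun f => ⟨(f.stem : Germ (cod Ω) (Cplx A)), f.stem, f.meromorphic_stem,
    by rw [f.conjStem_stem], rfl⟩) <| by
    constructor
    · intro f g h
      exact eq_of_stem (Germ.coe_eq.1 (congrArg Subtype.val h))
    · rintro ⟨_, F, hF, hs, rfl⟩
      obtain ⟨f, hf⟩ := exists_stem hF hs
      exact ⟨f, Subtype.ext (Germ.coe_eq.2 hf)⟩

noncomputable instance : NonAssocRing (Semiregular Ω) := (equivStemRing Ω).nonAssocRing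

theorem stem_zero : (0 : Semiregular Ω).stem =ᶠ[cod Ω] fun _ => 0 :=
  Germ.coe_eq.1 (congrArg Subtype.val ((equivStemRing Ω).apply_symm_apply 0))

theorem stem_one : (1 : Semiregular Ω).stem =ᶠ[cod Ω] fun _ => 1 :=
  Germ.coe_eq.1 (congrArg Subtype.val ((equivStemRing Ω).apply_symm_apply 1))

theorem stem_add (f g : Semiregular Ω) : (f + g).stem =ᶠ[cod Ω] fun z => f.stem z + g.stem z :=
  Germ.coe_eq.1 (congrArg Subtype.val
    ((equivStemRing Ω).apply_symm_apply (equivStemRing Ω f + equivStemRing Ω g)))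

theorem stem_mul (f g : Semiregular Ω) : (f * g).stem =ᶠ[cod Ω] fun z => f.stem z * g.stem z :=
  Germ.coe_eq.1 (congrArg Subtype.val
    ((equivStemRing Ω).apply_symm_apply (equivStemRing Ω f * equivStemRing Ω g)))

theorem exists_smul (r : ℝ) (f : Semiregular Ω) :
    ∃ g : Semiregular Ω, g.stem =ᶠ[cod Ω] fun z => r • f.stem z := by
  refine exists_stem (fun z hz => ?_) (Eventually.of_forall fun z => ?_)
  · exact (MeromorphicAt.const (r : ℂ) z).smul (f.meromorphic_stem z hz)
  · change ((r : ℂ) • f.stem (conj z)).bar = (r : ℂ) • f.stem z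
    rw [bar_smul, f.stem_conj, bar_bar, Complex.conj_ofReal]

theorem exists_star (f : Semiregular Ω) :
    ∃ g : Semiregular Ω, g.stem =ᶠ[cod Ω] fun z => star (f.stem z) := by
  refine exists_stem (fun z hz => meromorphicAt_star (f.meromorphic_stem z hz))
    (Eventually.of_forall fun z => ?_)
  change (star (f.stem (conj z))).bar = star (f.stem z)
  rw [bar_star, f.stem_conj, bar_bar]

noncomputable instance : SMul ℝ (Semiregular Ω) := ⟨fun r f => (exists_smul r f).choose⟩

noncomputable instance : Star (Semiregular Ω) := ⟨fun f => (exists_star f).choose⟩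

theorem stem_smul (r : ℝ) (f : Semiregular Ω) : (r • f).stem =ᶠ[cod Ω] fun z => r • f.stem z :=
  (exists_smul r f).choose_spec

theorem stem_star (f : Semiregular Ω) : (star f).stem =ᶠ[cod Ω] fun z => star (f.stem z) :=
  (exists_star f).choose_spec

/-- The germ of the stem function, as an additive map. -/
noncomputable def germHom : Semiregular Ω →+ Germ (cod Ω) (Cplx A) where
  toFun f := (f.stem : Germ (cod Ω) (Cplx A))
  map_zero' := Germ.coe_eq.2 stem_zero
  map_add' f g := Germ.coe_eq.2 (stem_add f g)

noncomputable instance : Module ℝ (Semiregular Ω) :=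
  Function.Injective.module ℝ germHom (fun _ _ h => eq_of_stem (Germ.coe_eq.1 h))
    fun r f => Germ.coe_eq.2 (stem_smul r f)

noncomputable instance : StarRing (Semiregular Ω) where
  star_involutive f := eq_of_stem <| by
    filter_upwards [stem_star f, stem_star (star f)] with z h1 h2
    rw [h2, h1, star_star]
  star_mul f g := eq_of_stem <| by
    filter_upwards [stem_star f, stem_star g, stem_star (f * g), stem_mul f g,
      stem_mul (star g) (star f)] with z h1 h2 h3 h4 h5
    rw [h3, h4, h5, h1, h2, star_mul]
  star_add f g := eq_of_stem <| by
    filter_upwards [stem_star f, stem_star g, stem_star (f + g), stem_add f g,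
      stem_add (star f) (star g)] with z h1 h2 h3 h4 h5
    rw [h3, h4, h5, h1, h2, star_add]

instance : IsAlternativeRing (Semiregular Ω) where
  left_alt f g := eq_of_stem <| by
    filter_upwards [stem_mul f f, stem_mul (f * f) g, stem_mul f g, stem_mul f (f * g)]
      with z h1 h2 h3 h4
    rw [h2, h1, h4, h3, IsAlternativeRing.left_alt]
  right_alt f g := eq_of_stem <| by
    filter_upwards [stem_mul f f, stem_mul (g * f) f, stem_mul g f, stem_mul g (f * f)]
      with z h1 h2 h3 h4
    rw [h2, h3, h4, h1, IsAlternativeRing.right_alt]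

/-- This is how domains of sums, products and conjugates are bounded below: where the pointwise
formula is analytic, the function with that germ is defined and has the expected value. -/
theorem mem_profile_dom_of_analyticAt {f : Semiregular Ω} {G : ℂ → Cplx A}
    (h : f.stem =ᶠ[cod Ω] G) {z : ℂ} (hz : z ∈ profile Ω) (hG : AnalyticAt ℂ G z) :
    z ∈ profile f.dom ∧ f.stem z = G z := by
  have h1 := f.stem_eq_of_eventuallyEq hΩ.out.1 hΩ.out.2.1 h hz hG.meromorphicNFAt
  refine ⟨?_, h1.eq_of_nhds⟩
  rw [f.profile_dom_eq hΩ.out.1 hΩ.out.2.1]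
  exact ⟨hz, hG.congr h1.symm⟩

theorem mem_dom_of_analyticAt {f : Semiregular Ω} {G : ℂ → Cplx A}
    (h : f.stem =ᶠ[cod Ω] G) {z : ℂ} (hz : z ∈ profile Ω) (hG : AnalyticAt ℂ G z) {J : A}
    (hJ : J ∈ imUnits A) :
    sliceEmb J z ∈ f.dom ∧ f.toFun (sliceEmb J z) = (G z).slice J := by
  obtain ⟨h1, h2⟩ := mem_profile_dom_of_analyticAt h hz hG
  exact ⟨(f.isCircular_dom.sliceEmb_mem_iff hJ).2 h1, by rw [f.apply_sliceEmb h1 hJ, h2]⟩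

theorem mem_and_apply_of_const {f : Semiregular Ω} {a : A}
    (h : f.stem =ᶠ[cod Ω] fun _ => const a) : f.dom = Ω ∧ ∀ x ∈ Ω, f.toFun x = a := by
  have key : ∀ x ∈ Ω, x ∈ f.dom ∧ f.toFun x = a := by
    intro x hx
    obtain ⟨z, hz, J, hJ, rfl⟩ := hΩ.out.1.exists_sliceEmb_eq hx
    have h1 := mem_dom_of_analyticAt h hz analyticAt_const hJ
    simpa [slice] using h1
  exact ⟨Set.Subset.antisymm f.semiregular.1 fun x hx => (key x hx).1, fun x hx => (key x hx).2⟩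

theorem profile_inter_left {f g : Semiregular Ω} {z : ℂ} (hz : z ∈ profile (f.dom ∩ g.dom)) :
    z ∈ profile f.dom := by
  obtain ⟨J, hJ, h⟩ := hz
  exact ⟨J, hJ, h.1⟩

theorem profile_inter_right {f g : Semiregular Ω} {z : ℂ} (hz : z ∈ profile (f.dom ∩ g.dom)) :
    z ∈ profile g.dom := by
  obtain ⟨J, hJ, h⟩ := hz
  exact ⟨J, hJ, h.2⟩

theorem slice_rsmul (r : ℝ) (J : A) (v : Cplx A) : (r • v).slice J = r • v.slice J := by
  simp [slice, mul_smul_comm]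

variable (Ω) in
theorem isSemiregularAlgebra : IsSemiregularAlgebra Ω where
  smul_mul r f g := eq_of_stem <| by
    filter_upwards [stem_smul r f, stem_mul (r • f) g, stem_mul f g, stem_smul r (f * g)]
      with z h1 h2 h3 h4
    rw [h2, h1, h4, h3]
    exact smul_mul_assoc (r : ℂ) _ _
  mul_smul r f g := eq_of_stem <| by
    filter_upwards [stem_smul r g, stem_mul f (r • g), stem_mul f g, stem_smul r (f * g)]
      with z h1 h2 h3 h4
    rw [h2, h1, h4, h3]
    exact mul_smul_comm (r : ℂ) _ _
  star_smul r f := eq_of_stem <| by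
    filter_upwards [stem_smul r f, stem_star (r • f), stem_star f, stem_smul r (star f)]
      with z h1 h2 h3 h4
    rw [h2, h1, h4, h3]
    exact star_csmul (r : ℂ) _
  left_alternative f g := IsAlternativeRing.left_alt f g
  right_alternative f g := IsAlternativeRing.right_alt f g
  zero_spec := mem_and_apply_of_const stem_zero
  one_spec := mem_and_apply_of_const stem_one
  add_spec f g := by
    have key : ∀ x ∈ f.dom ∩ g.dom, x ∈ (f + g).dom ∧
        (f + g).toFun x = f.toFun x + g.toFun x := by
      rintro x ⟨hf, hg⟩
      obtain ⟨z, hz, J, hJ, rfl⟩ := f.isCircular_dom.exists_sliceEmb_eq hf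
      have hz' : z ∈ profile g.dom := ⟨J, hJ, hg⟩
      have h1 := mem_dom_of_analyticAt (stem_add f g) (f.profile_dom_subset hz)
        ((f.analyticAt_stem_of_mem hz).add (g.analyticAt_stem_of_mem hz')) hJ
      rwa [slice_add, ← f.apply_sliceEmb hz hJ, ← g.apply_sliceEmb hz' hJ] at h1
    exact ⟨fun x hx => (key x hx).1, fun x hx => (key x hx).2⟩
  smul_spec r f := by
    have key : ∀ x ∈ f.dom, x ∈ (r • f).dom ∧ (r • f).toFun x = r • f.toFun x := by
      intro x hf
      obtain ⟨z, hz, J, hJ, rfl⟩ := f.isCircular_dom.exists_sliceEmb_eq hf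
      have h1 := mem_dom_of_analyticAt (stem_smul r f) (f.profile_dom_subset hz)
        ((analyticAt_const (v := (r : ℂ))).fun_smul (f.analyticAt_stem_of_mem hz)) hJ
      rwa [slice_rsmul, ← f.apply_sliceEmb hz hJ] at h1
    exact ⟨fun x hx => (key x hx).1, fun x hx => (key x hx).2⟩
  mul_spec f g := by
    have hi : ∀ z ∈ profile (f.dom ∩ g.dom), AnalyticAt ℂ (fun w => f.stem w * g.stem w) z :=
      fun z hz => analyticAt_mul (f.analyticAt_stem_of_mem (profile_inter_left hz))
        (g.analyticAt_stem_of_mem (profile_inter_right hz))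
    refine ⟨?_, f.stem, g.stem, f.isStemOn_stem _, g.isStemOn_stem _,
      f.induces_stem fun _ => profile_inter_left, g.induces_stem fun _ => profile_inter_right, ?_⟩
    · rintro x ⟨hf, hg⟩
      obtain ⟨z, hz, J, hJ, rfl⟩ := f.isCircular_dom.exists_sliceEmb_eq hf
      exact (mem_dom_of_analyticAt (stem_mul f g) (f.profile_dom_subset hz)
        (hi z ⟨J, hJ, hf, hg⟩) hJ).1
    · intro z hz J hJ
      exact (mem_dom_of_analyticAt (stem_mul f g)
        (f.profile_dom_subset (profile_inter_left hz)) (hi z hz) hJ).2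
  star_spec f := by
    refine ⟨?_, f.stem, f.isStemOn_stem _, f.induces_stem fun _ h => h, ?_⟩
    · intro x hf
      obtain ⟨z, hz, J, hJ, rfl⟩ := f.isCircular_dom.exists_sliceEmb_eq hf
      exact (mem_dom_of_analyticAt (stem_star f) (f.profile_dom_subset hz)
        (analyticAt_star (f.analyticAt_stem_of_mem hz)) hJ).1
    · intro z hz J hJ
      exact (mem_dom_of_analyticAt (stem_star f) (f.profile_dom_subset hz)
        (analyticAt_star (f.analyticAt_stem_of_mem hz)) hJ).2

/-! ### Identity theorem and nonsingularity -/

/-- Identity theorem: on a connected profile, infinite order of vanishing at one point spreads to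
all points. -/
theorem eventually_stem_ne_zero {f : Semiregular Ω} (hf : f ≠ 0) : ∀ᶠ z in cod Ω, f.stem z ≠ 0 := by
  refine f.meromorphic_stem.eventually_codiscreteWithin_apply_ne_zero fun x hx htop => hf ?_
  refine eq_of_stem (EventuallyEq.trans ?_ stem_zero.symm)
  refine (eventually_codiscreteWithin_iff (isOpen_dom_profile Ω)).2 fun y hy => ?_
  rw [← meromorphicOrderAt_eq_top_iff]
  by_contra hne
  exact f.meromorphic_stem.meromorphicOrderAt_ne_top_of_isPreconnected
    hΩ.out.2.2.1.isPreconnected hy hx hne htop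

theorem frequently_real_nhdsNE (r : ℝ) : ∃ᶠ z in 𝓝[≠] (r : ℂ), conj z = z := by
  have h : Tendsto (fun x : ℝ => (x : ℂ)) (𝓝[≠] r) (𝓝[≠] (r : ℂ)) := by
    refine tendsto_nhdsWithin_iff.2 ⟨(Complex.continuous_ofReal.tendsto r).mono_left
      nhdsWithin_le_nhds, ?_⟩
    filter_upwards [self_mem_nhdsWithin] with x hx h
    exact hx (Complex.ofReal_injective h)
  exact h.frequently (Eventually.frequently (Eventually.of_forall fun x => Complex.conj_ofReal x))

-- At real points the stem function has values in A, where nonsingularity applies. These points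
-- accumulate in D, contradicting the discreteness of the zeros of a nonzero stem function.
variable (Ω) in
theorem isNonsingular (hA : IsNonsingular A) : IsNonsingular (Semiregular Ω) := by
  intro f hf
  by_contra hne
  obtain ⟨r, hr⟩ := hΩ.out.2.2.2
  have hN : ∀ᶠ z in cod Ω, f.stem z * star (f.stem z) = 0 := by
    filter_upwards [stem_mul f (star f), stem_star f, stem_zero (Ω := Ω)] with z h1 h2 h3
    rw [← h2, ← h1, hf, h3]
  have h1 := (eventually_codiscreteWithin_iff (isOpen_dom_profile Ω)).1
    (hN.and (eventually_stem_ne_zero hne)) r hr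
  obtain ⟨z, hz, h2, h3⟩ := ((frequently_real_nhdsNE r).and_eventually h1).exists
  have him : (f.stem z).im = 0 := by
    have h4 := congrArg Cplx.im (f.stem_conj z)
    rw [hz, bar_im] at h4
    have h5 : (2 : ℝ) • (f.stem z).im = 0 := by
      rw [two_smul]
      exact eq_neg_iff_add_eq_zero.1 h4
    exact (smul_eq_zero.1 h5).resolve_left two_ne_zero
  have hre : (f.stem z).re = 0 := by
    have h4 := congrArg Cplx.re h2
    simp only [mul_re, star_re, star_im, him, star_zero, mul_zero, sub_zero, zero_re] at h4
    exact hA _ h4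
  exact h3 (Cplx.ext hre him)

end Semiregular

end SliceAlg

namespace SliceAlg

open Cplx

section Normal

variable {A : Type*} [NonAssocNormedRing A] [NormedSpace ℝ A] [StarRing A] [StarModule ℝ A]
  [IsScalarTower ℝ A A] [SMulCommClass ℝ A A] [AlternativeStarAlgebra A]

/-! ### Normal functions and stem functions -/

theorem IsSliceConj.stemOf_eq {Ω : Set A} {f g : A → A} (h : IsSliceConj Ω f g) {z : ℂ}
    (hz : z ∈ profile Ω) : stemOf g z = star (stemOf f z) := by
  obtain ⟨F, -, h1, h2⟩ := h
  rw [h1.stemOf_eq hz, h2.stemOf_eq hz]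

theorem IsNormalFun.stemOf_eq {Ω : Set A} {f p : A → A} (h : IsNormalFun Ω f p) {z : ℂ}
    (hz : z ∈ profile Ω) : stemOf p z = stemOf f z * star (stemOf f z) := by
  obtain ⟨g, hg, F, G, -, -, h1, h2, h3⟩ := h
  rw [h3.stemOf_eq hz, ← hg.stemOf_eq hz, h1.stemOf_eq hz, h2.stemOf_eq hz]

namespace Cplx

/-- The element `v` has a nonzero scalar normal element `v v^c = v^c v`. -/
def IsTameUnit (v : Cplx A) : Prop :=
  ∃ c : ℂ, c ≠ 0 ∧ v * star v = c • (1 : Cplx A) ∧ star v * v = c • (1 : Cplx A)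

theorem isTameUnit_one : IsTameUnit (1 : Cplx A) := ⟨1, one_ne_zero, by simp, by simp⟩

theorem IsTameUnit.star {v : Cplx A} (h : IsTameUnit v) : IsTameUnit (star v) := by
  obtain ⟨c, h0, h1, h2⟩ := h
  exact ⟨c, h0, by rwa [star_star], by rwa [star_star]⟩

theorem IsTameUnit.mul {v w : Cplx A} (hv : IsTameUnit v) (hw : IsTameUnit w) :
    IsTameUnit (v * w) := by
  obtain ⟨c, hc, h1, h2⟩ := hv
  obtain ⟨d, hd, h3, h4⟩ := hw
  refine ⟨c * d, mul_ne_zero hc hd, ?_, ?_⟩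
  · rw [star_mul]
    exact IsAlternativeRing.mul_mul_mul_of_scalar hc hd h1 h2 h3 h4
  · rw [star_mul, mul_comm c d]
    exact IsAlternativeRing.mul_mul_mul_of_scalar hd hc h4 h3 h2 h1

theorem IsTameUnit.smul {v : Cplx A} (hv : IsTameUnit v) {a : ℂ} (ha : a ≠ 0) :
    IsTameUnit (a • v) := by
  obtain ⟨c, hc, h1, h2⟩ := hv
  refine ⟨a * a * c, mul_ne_zero (mul_ne_zero ha ha) hc, ?_, ?_⟩ <;>
  · rw [star_csmul, smul_mul_smul_comm]
    simp only [h1, h2, smul_smul]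

end Cplx

end Normal

namespace Semiregular

variable {A : Type*} [NonAssocNormedRing A] [NormedSpace ℝ A] [StarRing A] [StarModule ℝ A]
  [IsScalarTower ℝ A A] [SMulCommClass ℝ A A] [AlternativeStarAlgebra A] [Nontrivial A]
  [FiniteDimensional ℝ A] {Ω : Set A} [hΩ : Fact (IsSliceDomain Ω)]

/-! ### Tame semiregular functions -/

theorem eventually_mem_profile_dom (f : Semiregular Ω) : ∀ᶠ z in cod Ω, z ∈ profile f.dom := by
  rw [f.profile_dom_eq hΩ.out.1 hΩ.out.2.1]
  exact (eventually_codiscreteWithin_iff (isOpen_dom_profile Ω)).2 fun z hz =>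
    eventually_mem_regularSet (isOpen_dom_profile Ω) hz (f.meromorphic_stem z hz)

/-- Tameness becomes a scalar condition on the values of the stem function. It need only be checked
off a discrete set, since continuity extends it to the whole domain. -/
theorem isTameOn_iff (f : Semiregular Ω) : IsTameOn f.dom f.toFun ↔
    ∀ᶠ z in cod Ω, ∃ c : ℂ, f.stem z * star (f.stem z) = c • (1 : Cplx A) ∧
      star (f.stem z) * f.stem z = c • (1 : Cplx A) := by
  constructor
  · rintro ⟨p, hp, ⟨P, -, hP, hreal⟩, g, hg, hgp⟩
    filter_upwards [f.eventually_mem_profile_dom] with z hz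
    obtain ⟨c, hc⟩ := (isReal_iff _).1 (hreal z hz)
    have h1 := hp.stemOf_eq hz
    have h2 := hgp.stemOf_eq hz
    rw [hg.stemOf_eq hz, star_star] at h2
    rw [hP.stemOf_eq hz, hc] at h1 h2
    exact ⟨c, h1.symm, h2.symm⟩
  · intro h
    have key : ∀ z ∈ profile f.dom, ∃ c : ℂ, f.stem z * star (f.stem z) = c • (1 : Cplx A) ∧
        star (f.stem z) * f.stem z = c • (1 : Cplx A) := by
      intro z hz
      -- That both normal elements equal the same scalar means membership in a line, which is
      -- closed; limits therefore stay in it.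
      let V : Submodule ℂ (Cplx A × Cplx A) := Submodule.span ℂ {(1, 1)}
      have hV : ∀ v : Cplx A × Cplx A, v ∈ V ↔
          ∃ c : ℂ, v.1 = c • (1 : Cplx A) ∧ v.2 = c • (1 : Cplx A) := by
        intro v
        rw [Submodule.mem_span_singleton]
        exact exists_congr fun c => ⟨fun hc => by rw [← hc]; exact ⟨rfl, rfl⟩,
          fun hc => Prod.ext hc.1.symm hc.2.symm⟩
      have ha := f.analyticAt_stem_of_mem hz
      have h1 := (analyticAt_mul ha (analyticAt_star ha)).continuousAt
      have h2 := (analyticAt_mul (analyticAt_star ha) ha).continuousAt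
      have h3 := (h1.prodMk h2).tendsto.mono_left (nhdsWithin_le_nhds (s := {z}ᶜ))
      refine (hV _).1 (V.closed_of_finiteDimensional.mem_of_tendsto h3 ?_)
      filter_upwards [(eventually_codiscreteWithin_iff (isOpen_dom_profile Ω)).1 h z
        (f.profile_dom_subset hz)] with w hw
      exact (hV _).2 hw
    set D := profile f.dom with hD
    have hsN : conjStem (fun z => f.stem z * star (f.stem z))
        = fun z => f.stem z * star (f.stem z) := by
      funext z
      simp only [conjStem, f.stem_conj, bar_mul, bar_star, bar_bar]
    have hsS : conjStem (fun z => star (f.stem z)) = fun z => star (f.stem z) := by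
      funext z
      simp only [conjStem, f.stem_conj, bar_star, bar_bar]
    have hf : Induces D f.stem f.toFun := f.induces_stem fun _ h => h
    have hg : IsSliceConj f.dom f.toFun (sliceFun D fun z => star (f.stem z)) :=
      ⟨f.stem, f.isStemOn_stem _, hf, induces_sliceFun D hsS⟩
    have hp := induces_sliceFun D hsN
    refine ⟨sliceFun D fun z => f.stem z * star (f.stem z), ⟨_, hg, f.stem,
      fun z => star (f.stem z), f.isStemOn_stem _, isStemOn_of_conjStem_eq D hsS, hf,
      induces_sliceFun D hsS, hp⟩, ⟨_, isStemOn_of_conjStem_eq D hsN, hp, fun z hz => ?_⟩,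
      _, hg, f.toFun, ⟨fun z => star (f.stem z), isStemOn_of_conjStem_eq D hsS,
      induces_sliceFun D hsS, ?_⟩, fun z => star (f.stem z), f.stem,
      isStemOn_of_conjStem_eq D hsS, f.isStemOn_stem _, induces_sliceFun D hsS, hf, ?_⟩
    · obtain ⟨c, hc, -⟩ := key z hz
      exact (isReal_iff _).2 ⟨c, hc⟩
    · simpa only [star_star] using hf
    · intro z hz J hJ
      obtain ⟨c, h1, h2⟩ := key z hz
      rw [hp z hz J hJ]
      simp only [h1, h2]

theorem exists_apply_ne_zero_iff (f : Semiregular Ω) : (∃ x ∈ f.dom, f.toFun x ≠ 0) ↔ f ≠ 0 := by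
  constructor
  · rintro ⟨x, hx, h⟩ rfl
    exact h ((isSemiregularAlgebra Ω).zero_spec.2 x ((isSemiregularAlgebra Ω).zero_spec.1 ▸ hx))
  · intro h
    by_contra! h0
    refine h (eq_of_stem (EventuallyEq.trans (Eventually.of_forall fun z => ?_) stem_zero.symm))
    refine stemOf_eq_of_slice fun J hJ => ?_
    have h1 : f.toFun (sliceEmb J z) = 0 := by
      by_cases hz : sliceEmb J z ∈ f.dom
      · exact h0 _ hz
      · exact f.eq_zero_off _ hz
    simp [h1, slice]

/-- Nonsingularity is what makes the scalar nonzero: N(f) does not vanish identically, so its zeros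
are discrete. -/
theorem mem_tameNonzero_iff (hA : IsNonsingular A) (f : Semiregular Ω) :
    f ∈ tameNonzero Ω ↔ ∀ᶠ z in cod Ω, IsTameUnit (f.stem z) := by
  change IsTameOn f.dom f.toFun ∧ (∃ x ∈ f.dom, f.toFun x ≠ 0) ↔ _
  rw [isTameOn_iff, exists_apply_ne_zero_iff]
  constructor
  · rintro ⟨h1, h2⟩
    have h3 : f * star f ≠ 0 := fun h => h2 (isNonsingular Ω hA f h)
    filter_upwards [h1, eventually_stem_ne_zero h3, stem_mul f (star f), stem_star f]
      with z hz h4 h5 h6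
    obtain ⟨c, h7, h8⟩ := hz
    refine ⟨c, ?_, h7, h8⟩
    rintro rfl
    rw [h5, h6, h7, zero_smul] at h4
    exact h4 rfl
  · intro h
    refine ⟨h.mono fun z ⟨c, _, h1⟩ => ⟨c, h1⟩, ?_⟩
    rintro rfl
    obtain ⟨z, ⟨c, hc, h1, -⟩, h2⟩ := (h.and stem_zero).exists
    rw [h2, zero_mul] at h1
    have h3 := congrArg Cplx.re h1
    have h4 := congrArg Cplx.im h1
    simp only [zero_re, zero_im, smul_re, smul_im, one_re, one_im, smul_zero, sub_zero,
      zero_add] at h3 h4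
    refine hc (Complex.ext ?_ ?_)
    · exact (smul_eq_zero.1 h3.symm).resolve_right one_ne_zero
    · have h5 : c.im • (1 : A) = 0 := by simpa using h4.symm
      exact (smul_eq_zero.1 h5).resolve_right one_ne_zero

/-- The inverse is N(f)⁻¹ · f^c, with N(f) a meromorphic complex scalar. -/
theorem exists_inverse (hA : IsNonsingular A) {f : Semiregular Ω} (hf : f ∈ tameNonzero Ω) :
    ∃ g ∈ tameNonzero Ω, ∀ x, g * (f * x) = x ∧ f * (g * x) = x ∧ (x * f) * g = x ∧
      (x * g) * f = x := by
  rw [mem_tameNonzero_iff hA] at hf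
  have h1 : (1 : Cplx A) ≠ 0 := fun h => one_ne_zero (α := A) (congrArg Cplx.re h)
  obtain ⟨φ, hφ⟩ := SeparatingDual.exists_eq_one (R := ℂ) h1
  -- A functional with φ(1) = 1 extracts the scalar, so that its meromorphy and its symmetry come
  -- from those of the normal function.
  set c : ℂ → ℂ := fun z => φ (f.stem z * star (f.stem z)) with hc
  have hcf : ∀ᶠ z in cod Ω, c z ≠ 0 ∧ f.stem z * star (f.stem z) = c z • (1 : Cplx A) ∧
      star (f.stem z) * f.stem z = c z • (1 : Cplx A) := by
    filter_upwards [hf] with z hz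
    obtain ⟨d, hd, h2, h3⟩ := hz
    have h4 : c z = d := by simp [hc, h2, hφ]
    rw [h4]
    exact ⟨hd, h2, h3⟩
  have hcm : ∀ z ∈ profile Ω, MeromorphicAt c z := by
    intro z hz
    obtain ⟨n, hn⟩ := meromorphicAt_mul (f.meromorphic_stem z hz)
      (meromorphicAt_star (f.meromorphic_stem z hz))
    refine ⟨n, ((φ.analyticAt _).comp hn).congr (Eventually.of_forall fun w => ?_)⟩
    simp [hc]
  obtain ⟨g, hg⟩ : ∃ g : Semiregular Ω, g.stem =ᶠ[cod Ω] fun z => (c z)⁻¹ • star (f.stem z) := by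
    refine exists_stem (fun z hz => (hcm z hz).inv.smul
      (meromorphicAt_star (f.meromorphic_stem z hz))) ?_
    filter_upwards [hcf, eventually_conj hcf] with z h2 h3
    have h4 : conj (c (conj z)) = c z := by
      have h5 := congrArg bar h3.2.1
      rw [f.stem_conj, bar_mul, bar_star, bar_bar, h2.2.1, bar_smul, bar_one] at h5
      have h6 := congrArg φ h5
      rw [map_smul, map_smul, hφ, smul_eq_mul, smul_eq_mul, mul_one, mul_one] at h6
      exact h6.symm
    simp only [conjStem, bar_smul, f.stem_conj, bar_star, bar_bar, map_inv₀, h4]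
  refine ⟨g, (mem_tameNonzero_iff hA g).2 ?_, fun x => ⟨?_, ?_, ?_, ?_⟩⟩
  · filter_upwards [hcf, hf, hg] with z h2 h3 h4
    rw [h4]
    exact h3.star.smul (inv_ne_zero h2.1)
  all_goals refine eq_of_stem ?_
  · filter_upwards [hcf, hg, stem_mul f x, stem_mul g (f * x)] with z h2 h3 h4 h5
    rw [h5, h4, h3, smul_mul_assoc,
      IsAlternativeRing.mul_mul_cancel_left_of_scalar h2.1 h2.2.1 h2.2.2, inv_smul_smul₀ h2.1]
  · filter_upwards [hcf, hg, stem_mul g x, stem_mul f (g * x)] with z h2 h3 h4 h5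
    rw [h5, h4, h3, smul_mul_assoc, mul_smul_comm,
      IsAlternativeRing.mul_mul_cancel_left_of_scalar h2.1 h2.2.2 h2.2.1, inv_smul_smul₀ h2.1]
  · filter_upwards [hcf, hg, stem_mul x f, stem_mul (x * f) g] with z h2 h3 h4 h5
    rw [h5, h4, h3, mul_smul_comm,
      IsAlternativeRing.mul_mul_cancel_right_of_scalar h2.1 h2.2.1 h2.2.2, inv_smul_smul₀ h2.1]
  · filter_upwards [hcf, hg, stem_mul x g, stem_mul (x * g) f] with z h2 h3 h4 h5
    rw [h5, h4, h3, mul_smul_comm, smul_mul_assoc,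
      IsAlternativeRing.mul_mul_cancel_right_of_scalar h2.1 h2.2.2 h2.2.1, inv_smul_smul₀ h2.1]

theorem mul_mem_tameNonzero (hA : IsNonsingular A) {f g : Semiregular Ω} (hf : f ∈ tameNonzero Ω)
    (hg : g ∈ tameNonzero Ω) : f * g ∈ tameNonzero Ω := by
  rw [mem_tameNonzero_iff hA] at hf hg ⊢
  filter_upwards [hf, hg, stem_mul f g] with z h1 h2 h3
  rw [h3]
  exact h1.mul h2

theorem one_mem_tameNonzero (hA : IsNonsingular A) : (1 : Semiregular Ω) ∈ tameNonzero Ω := by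
  rw [mem_tameNonzero_iff hA]
  filter_upwards [stem_one (Ω := Ω)] with z hz
  rw [hz]
  exact isTameUnit_one

theorem star_mem_tameNonzero (hA : IsNonsingular A) {f : Semiregular Ω} (hf : f ∈ tameNonzero Ω) :
    star f ∈ tameNonzero Ω := by
  rw [mem_tameNonzero_iff hA] at hf ⊢
  filter_upwards [hf, stem_star f] with z h1 h2
  rw [h2]
  exact h1.star

variable (Ω) in
theorem isMoufangLoop_tameNonzero (hA : IsNonsingular A) : IsMoufangLoop (tameNonzero Ω) where
  mul_mem _ ha _ hb := mul_mem_tameNonzero hA ha hb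
  exists_one := ⟨1, one_mem_tameNonzero hA, fun a _ => ⟨one_mul a, mul_one a⟩⟩
  left_div a ha b hb := by
    obtain ⟨g, hg, h⟩ := exists_inverse hA ha
    refine ⟨g * b, ⟨mul_mem_tameNonzero hA hg hb, (h b).2.1⟩, ?_⟩
    rintro y ⟨-, rfl⟩
    exact (h y).1.symm
  right_div a ha b hb := by
    obtain ⟨g, hg, h⟩ := exists_inverse hA ha
    refine ⟨b * g, ⟨mul_mem_tameNonzero hA hb hg, (h b).2.2.2⟩, ?_⟩
    rintro y ⟨-, rfl⟩
    exact (h y).2.2.1.symm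
  moufang_left x _ y _ z _ := IsAlternativeRing.moufang_left x y z
  moufang_right x _ y _ z _ := IsAlternativeRing.moufang_right x y z
  moufang_middle x _ y _ z _ := IsAlternativeRing.moufang_middle x y z
  moufang_middle' x _ y _ z _ := IsAlternativeRing.moufang_middle' x y z

end Semiregular

end SliceAlg

/-! ### The main theorem -/

theorem mainTheorem7 {A : Type*} [NonAssocNormedRing A] [NormedSpace ℝ A] [IsScalarTower ℝ A A]
    [SMulCommClass ℝ A A] [StarRing A] [StarModule ℝ A] [FiniteDimensional ℝ A] [Nontrivial A]
    [SliceAlg.AlternativeStarAlgebra A] (hA : SliceAlg.IsNonsingular A)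
    (Ω : Set A) (hΩ : SliceAlg.IsSliceDomain Ω) :
    ∃ (_ : NonAssocRing (SliceAlg.Semiregular Ω)) (_ : Module ℝ (SliceAlg.Semiregular Ω))
      (_ : StarRing (SliceAlg.Semiregular Ω)),
      SliceAlg.IsSemiregularAlgebra Ω ∧
      SliceAlg.IsNonsingular (SliceAlg.Semiregular Ω) ∧
      SliceAlg.IsMoufangLoop (SliceAlg.tameNonzero Ω) ∧
      ∀ f ∈ SliceAlg.tameNonzero Ω, star f ∈ SliceAlg.tameNonzero Ω := by
  have : Fact (SliceAlg.IsSliceDomain Ω) := ⟨hΩ⟩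
  exact ⟨inferInstance, inferInstance, inferInstance, SliceAlg.Semiregular.isSemiregularAlgebra Ω,
    SliceAlg.Semiregular.isNonsingular Ω hA, SliceAlg.Semiregular.isMoufangLoop_tameNonzero Ω hA,
    fun _ hf => SliceAlg.Semiregular.star_mem_tameNonzero hA hf⟩
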